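/- Let $n\ge 1$, $1<p<\infty$, and let $\Omega\subset\mathbb{R}^n$ be open and bounded with boundary of class $C^2$; let $\nu$ be the surface measure on $\partial\Omega$ (counting measure if $n=1$). Let $\Gamma\subseteq\partial\Omega$ satisfy $\nu(\Gamma)>0$, and let $\sigma:\partial\Omega\to[0,+\infty]$ be $\nu$-measurable with $\sigma=+\infty$ on $\Gamma$ and $\sigma\in L^\infty(\partial\Omega\setminus\overline{\Gamma})$. Let $W^{1,p}_{0,\Gamma}(\Omega)$ be the closure in $W^{1,p}(\Omega)$ of $\{u\in C^1(\overline\Omega): u|_\Gamma=0\}$. Put $\delta(x)=\min_{y\in\partial\Omega}|x-y|$ for $x\in\Omega$; for almost every $x\in\Omega$ this minimum is attained at a unique point $\pi(x)\in\partial\Omega$, and for such $x$ put $$\alpha(x)=\frac{p-1}{p}\,\sigma(\pi(x))^{\frac{1}{1-p}}\in[0,+\infty]$$ (so $\alpha(x)=0$ if $\sigma(\pi(x))=+\infty$ and $\alpha(x)=+\infty$ if $\sigma(\pi(x))=0$). Define $$\lambda_p(\Omega,\sigma)=\inf_{u}\ \frac{\int_\Omega|\nabla u|^p\,dx+\int_{\partial\Omega}\sigma\,|u|^p\,d\nu}{\int_\Omega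 \frac{|u(x)|^p}{(\delta(x)+\alpha(x))^p}\,dx},$$ where the infimum is over all $u\in W^{1,p}_{0,\Gamma}(\Omega)$ for which the denominator is positive and finite, $u$ is understood in the sense of traces on $\partial\Omega$, and $\infty\cdot 0=0$ in the boundary integral. Then $$\lambda_p(\Omega,\sigma)\le C_p:=\Big(\frac{p-1}{p}\Big)^p .$$ -/

import Mathlib

open Set Filter Topology MeasureTheory
open scoped ENNReal NNReal Gradient RealInnerProductSpace

noncomputable section

namespace RobinHardy

/-- The boundary of `Ω` is of class `C²`: near each boundary point `y` there is a unit vector `e`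
such that `Ω` coincides, in a ball around `y`, with the region lying strictly above the graph (in
the direction `e`) of a `C²` function `γ` on the hyperplane orthogonal to `e`. -/
def HasC2Boundary {n : ℕ} (Ω : Set (EuclideanSpace ℝ (Fin n))) : Prop :=
  ∀ y ∈ frontier Ω, ∃ e : EuclideanSpace ℝ (Fin n), ‖e‖ = 1 ∧
    ∃ γ : ↥((Submodule.span ℝ {e})ᗮ) → ℝ, ContDiff ℝ 2 γ ∧
      ∃ r : ℝ, 0 < r ∧ ∀ x ∈ Metric.ball y r,
        (x ∈ Ω ↔ γ ((Submodule.span ℝ {e})ᗮ.orthogonalProjectionOnto x) < ⟪e, x⟫)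

/-- The surface measure `ν` on `∂Ω`: the `(n-1)`-dimensional Hausdorff measure, normalised so as to
agree with Lebesgue measure on `(n-1)`-dimensional Euclidean spaces (counting measure if `n = 1`),
restricted to `∂Ω`. -/
def surfaceMeasure {n : ℕ} (Ω : Set (EuclideanSpace ℝ (Fin n))) :
    Measure (EuclideanSpace ℝ (Fin n)) :=
  (μHE[n - 1]).restrict (frontier Ω)

/-- The class `Σ_Γ` of Robin coefficients `σ : ∂Ω → [0, ∞]` (only the values of `σ` on `∂Ω` are
ever used): measurable, equal to `∞` on `Γ`, essentially bounded on `∂Ω` minus the closure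
of `Γ`. -/
structure IsRobinCoefficient {n : ℕ} (Ω Γ : Set (EuclideanSpace ℝ (Fin n)))
    (σ : EuclideanSpace ℝ (Fin n) → ℝ≥0∞) : Prop where
  aemeasurable : AEMeasurable σ (surfaceMeasure Ω)
  eq_top : ∀ y ∈ Γ, σ y = ∞
  bounded : ∃ M : ℝ≥0, ∀ᵐ y ∂((surfaceMeasure Ω).restrict (closure Γ)ᶜ), σ y ≤ M

/-- The distance `δ(x)` to the boundary. -/
def bdryDist {n : ℕ} (Ω : Set (EuclideanSpace ℝ (Fin n))) (x : EuclideanSpace ℝ (Fin n)) : ℝ :=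
  Metric.infDist x (frontier Ω)

/-- The singular set `S`: points of `Ω` with at least two nearest boundary points. -/
def singularSet {n : ℕ} (Ω : Set (EuclideanSpace ℝ (Fin n))) : Set (EuclideanSpace ℝ (Fin n)) :=
  {x | x ∈ Ω ∧ ∃ y₁ ∈ frontier Ω, ∃ y₂ ∈ frontier Ω,
    y₁ ≠ y₂ ∧ dist x y₁ = bdryDist Ω x ∧ dist x y₂ = bdryDist Ω x}

/-- `π(x)`: the nearest boundary point (it is unique for `x ∈ Ω \ S`, and the function is only used
there). -/
def nearestPoint {n : ℕ} (Ω : Set (EuclideanSpace ℝ (Fin n))) (x : EuclideanSpace ℝ (Fin n)) :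
    EuclideanSpace ℝ (Fin n) :=
  Classical.epsilon fun y => y ∈ frontier Ω ∧ dist x y = bdryDist Ω x

/-- `α(x) = (p-1)/p · σ(π(x))^{1/(1-p)} ∈ [0, ∞]`, with `α(x) = 0` if `σ(π(x)) = ∞` and `α(x) = ∞`
if `σ(π(x)) = 0`. -/
def robinAlpha {n : ℕ} (p : ℝ) (Ω : Set (EuclideanSpace ℝ (Fin n)))
    (σ : EuclideanSpace ℝ (Fin n) → ℝ≥0∞) (x : EuclideanSpace ℝ (Fin n)) : ℝ≥0∞ :=
  ENNReal.ofReal ((p - 1) / p) * σ (nearestPoint Ω x) ^ (1 / (1 - p))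

/-- `φ ∈ C¹(Ω̄)`: `φ` is continuous on `Ω̄`, differentiable in `Ω`, and its gradient in `Ω` extends
continuously to `Ω̄`. -/
def IsC1UpToBoundary {n : ℕ} (Ω : Set (EuclideanSpace ℝ (Fin n)))
    (φ : EuclideanSpace ℝ (Fin n) → ℝ) : Prop :=
  ContinuousOn φ (closure Ω) ∧ DifferentiableOn ℝ φ Ω ∧
    ∃ g : EuclideanSpace ℝ (Fin n) → EuclideanSpace ℝ (Fin n),
      ContinuousOn g (closure Ω) ∧ ∀ x ∈ Ω, ∇ φ x = g x

/-- `G` is the weak gradient of `u` in `Ω`. -/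
def IsWeakGradient {n : ℕ} (Ω : Set (EuclideanSpace ℝ (Fin n)))
    (u : EuclideanSpace ℝ (Fin n) → ℝ)
    (G : EuclideanSpace ℝ (Fin n) → EuclideanSpace ℝ (Fin n)) : Prop :=
  ∀ η : EuclideanSpace ℝ (Fin n) → ℝ, ContDiff ℝ (⊤ : ℕ∞) η → HasCompactSupport η →
    tsupport η ⊆ Ω → ∀ v : EuclideanSpace ℝ (Fin n),
      ∫ x in Ω, u x * fderiv ℝ η x v = - ∫ x in Ω, η x * ⟪G x, v⟫

/-- `u ∈ W^{1,p}(Ω)`, with weak gradient `G`. -/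
structure MemW1p {n : ℕ} (p : ℝ) (Ω : Set (EuclideanSpace ℝ (Fin n)))
    (u : EuclideanSpace ℝ (Fin n) → ℝ)
    (G : EuclideanSpace ℝ (Fin n) → EuclideanSpace ℝ (Fin n)) : Prop where
  memLp : MemLp u (ENNReal.ofReal p) (volume.restrict Ω)
  memLp_grad : MemLp G (ENNReal.ofReal p) (volume.restrict Ω)
  weakGradient : IsWeakGradient Ω u G

/-- The functions `φ k` (differentiable in `Ω`) converge in the norm of `W^{1,p}(Ω)` to the function
`u` with weak gradient `G`. -/
def TendstoW1p {n : ℕ} (p : ℝ) (Ω : Set (EuclideanSpace ℝ (Fin n)))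
    (φ : ℕ → EuclideanSpace ℝ (Fin n) → ℝ) (u : EuclideanSpace ℝ (Fin n) → ℝ)
    (G : EuclideanSpace ℝ (Fin n) → EuclideanSpace ℝ (Fin n)) : Prop :=
  Tendsto (fun k => eLpNorm (fun x => φ k x - u x) (ENNReal.ofReal p) (volume.restrict Ω))
      atTop (𝓝 0) ∧
    Tendsto (fun k => eLpNorm (fun x => ∇ (φ k) x - G x) (ENNReal.ofReal p) (volume.restrict Ω))
      atTop (𝓝 0)

/-- `u ∈ W^{1,p}_{0,Γ}(Ω)`, with weak gradient `G`: `u` belongs to the closure, in `W^{1,p}(Ω)`, of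
the functions of class `C¹(Ω̄)` that vanish on `Γ`. -/
def MemW1pZero {n : ℕ} (p : ℝ) (Ω Γ : Set (EuclideanSpace ℝ (Fin n)))
    (u : EuclideanSpace ℝ (Fin n) → ℝ)
    (G : EuclideanSpace ℝ (Fin n) → EuclideanSpace ℝ (Fin n)) : Prop :=
  MemW1p p Ω u G ∧ ∃ φ : ℕ → EuclideanSpace ℝ (Fin n) → ℝ,
    (∀ k, IsC1UpToBoundary Ω (φ k) ∧ ∀ y ∈ Γ, φ k y = 0) ∧ TendstoW1p p Ω φ u G

/-- `T` is the trace on `∂Ω` of `u ∈ W^{1,p}(Ω)` (with weak gradient `G`), i.e. the value at `u` of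
the continuous extension to `W^{1,p}(Ω)`, with values in `L^p(∂Ω)`, of the restriction map
`φ ↦ φ|_{∂Ω}` on `C¹(Ω̄)`. -/
def IsTrace {n : ℕ} (p : ℝ) (Ω : Set (EuclideanSpace ℝ (Fin n)))
    (u : EuclideanSpace ℝ (Fin n) → ℝ)
    (G : EuclideanSpace ℝ (Fin n) → EuclideanSpace ℝ (Fin n))
    (T : EuclideanSpace ℝ (Fin n) → ℝ) : Prop :=
  MemLp T (ENNReal.ofReal p) (surfaceMeasure Ω) ∧
    ∃ φ : ℕ → EuclideanSpace ℝ (Fin n) → ℝ,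
      (∀ k, IsC1UpToBoundary Ω (φ k)) ∧ TendstoW1p p Ω φ u G ∧
        Tendsto (fun k => eLpNorm (fun y => φ k y - T y) (ENNReal.ofReal p) (surfaceMeasure Ω))
          atTop (𝓝 0)

/-- `Q_p[σ, u] = ∫_Ω |∇u|^p dx + ∫_{∂Ω} σ |u|^p dν`, for a function `u` with weak gradient `G` and
trace `T`, as an element of `[0, ∞]` (with `∞ · 0 = 0` under the second integral). -/
def robinEnergy {n : ℕ} (p : ℝ) (Ω : Set (EuclideanSpace ℝ (Fin n)))
    (σ : EuclideanSpace ℝ (Fin n) → ℝ≥0∞)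
    (G : EuclideanSpace ℝ (Fin n) → EuclideanSpace ℝ (Fin n))
    (T : EuclideanSpace ℝ (Fin n) → ℝ) : ℝ≥0∞ :=
  (∫⁻ x in Ω, ‖G x‖ₑ ^ p) + ∫⁻ y, σ y * ‖T y‖ₑ ^ p ∂(surfaceMeasure Ω)

/-- `‖u‖_{p,σ}^p = ∫_Ω |u|^p / (δ + α)^p dx`, as an element of `[0, ∞]`; the integrand is defined on
`Ω \ S`, and `S` is a null set. -/
def weightedNormPow {n : ℕ} (p : ℝ) (Ω : Set (EuclideanSpace ℝ (Fin n)))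
    (σ : EuclideanSpace ℝ (Fin n) → ℝ≥0∞) (u : EuclideanSpace ℝ (Fin n) → ℝ) : ℝ≥0∞ :=
  ∫⁻ x in Ω \ singularSet Ω,
    ‖u x‖ₑ ^ p / (ENNReal.ofReal (bdryDist Ω x) + robinAlpha p Ω σ x) ^ p

/-- `λ_p(Ω, σ)`: the infimum of `Q_p[σ, u] / ‖u‖_{p,σ}^p` over all `u ∈ W^{1,p}_{0,Γ}(Ω)` for which
the denominator is neither `0` nor `∞` (an infimum over the empty set would be `∞`). -/
def hardyConstant {n : ℕ} (p : ℝ) (Ω Γ : Set (EuclideanSpace ℝ (Fin n)))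
    (σ : EuclideanSpace ℝ (Fin n) → ℝ≥0∞) : ℝ≥0∞ :=
  ⨅ (u : EuclideanSpace ℝ (Fin n) → ℝ)
    (G : EuclideanSpace ℝ (Fin n) → EuclideanSpace ℝ (Fin n))
    (T : EuclideanSpace ℝ (Fin n) → ℝ)
    (_ : MemW1pZero p Ω Γ u G) (_ : IsTrace p Ω u G T)
    (_ : weightedNormPow p Ω σ u ≠ 0) (_ : weightedNormPow p Ω σ u ≠ ∞),
    robinEnergy p Ω σ G T / weightedNormPow p Ω σ u

end RobinHardy

end

/-! Where `σ = ∞` the shift `α` vanishes and the weight is `δ⁻ᵖ`, so functions with compact support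
in `Ω`, concentrated near such boundary points, meet the classical Hardy quotient, whose sharp
constant is `((p-1)/p)^p`. They have trace zero and pay nothing in the boundary integral.

With `a = (p-1)/p`, the test function is `u = δ^a h(log δ / L + 4) χ(π)`, with `h` a fixed bump and
`χ` a tangential cutoff. Near `∂Ω` its gradient has norm at most `δ^(-1/p) (a h + O(1/L))`, and
where `χ = 1` and `α = 0` one has `(u/δ)^p = δ⁻¹ h^p`. Since `dδ/δ = L ds` in the logarithmic
variable `s`, main terms grow like `L`, while the error, once raised to the power `p`, contributes
`L · L⁻ᵖ`. It is negligible as `L → ∞`.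

Normal coordinates at a `C²` boundary point (`HasC2Boundary.nonempty_normalChart`) make `δ` and `π`
explicit. That `δ` is 1-Lipschitz gives the normal derivative its sharp bound
(`NormalChart.norm_fderiv_push_le`); tangential derivatives need only some bound.

The set `{σ = ∞}` is merely measurable in the chart, of positive measure
(`NormalChart.exists_measurableSet_sigma_eq_top`). So `χ` is `1` on a compact part `K` of it and
supported in an open `U` with `|U \ K| ≤ η |K|` (`exists_contDiff_cutoff`); the weight is kept over
`K` only. The Jacobian of the chart is just bounded above and below, but over `K` the same integral
appears in numerator and denominator, so the distortion multiplies only `η` and the error. This is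
`NormalChart.hardyConstant_le_of_cutoff`; then `L → ∞` and `η → 0`. -/

namespace RobinHardy

/-! ### Splitting the space into a line and its orthogonal hyperplane -/

section Hyperplane

variable {E : Type*} [NormedAddCommGroup E] [InnerProductSpace ℝ E]

/-- The hyperplane orthogonal to `e`. -/
noncomputable abbrev hyperplane (e : E) : Submodule ℝ E := (Submodule.span ℝ {e})ᗮ

/-- The orthogonal projection onto the hyperplane orthogonal to `e`. -/
noncomputable abbrev hyperproj (e : E) : E →L[ℝ] hyperplane e :=
  (hyperplane e).orthogonalProjectionOnto

theorem inner_coe_hyperplane (e : E) (z : hyperplane e) : ⟪e, (z : E)⟫ = 0 :=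
  Submodule.mem_orthogonal_singleton_iff_inner_right.1 z.2

theorem hyperproj_self (e : E) : hyperproj e e = 0 :=
  Submodule.orthogonalProjectionOnto_orthogonalComplement_singleton_eq_zero e

theorem hyperproj_coe (e : E) (z : hyperplane e) : hyperproj e (z : E) = z :=
  Submodule.orthogonalProjectionOnto_mem_subspace_eq_self z

theorem inner_coe_hyperproj (e : E) (z : hyperplane e) (x : E) :
    ⟪z, hyperproj e x⟫ = ⟪(z : E), x⟫ :=
  Submodule.inner_orthogonalProjectionOnto_eq_of_mem_left z x

variable {e : E}

theorem hyperproj_add_inner_smul (he : ‖e‖ = 1) (x : E) :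
    (hyperproj e x : E) + ⟪e, x⟫ • e = x := by
  have h : (Submodule.span ℝ {e}).starProjection x + (hyperproj e x : E) = x :=
    Submodule.starProjection_add_starProjection_orthogonal (K := Submodule.span ℝ {e}) x
  rw [Submodule.starProjection_unit_singleton ℝ he] at h
  rw [add_comm]; exact h

theorem hyperproj_coe_add_smul (z : hyperplane e) (t : ℝ) :
    hyperproj e ((z : E) + t • e) = z := by
  rw [map_add, map_smul, hyperproj_coe, hyperproj_self, smul_zero, add_zero]

theorem inner_coe_add_smul (he : ‖e‖ = 1) (z : hyperplane e) (t : ℝ) :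
    ⟪e, (z : E) + t • e⟫ = t := by
  rw [inner_add_right, inner_coe_hyperplane, inner_smul_right, real_inner_self_eq_norm_sq, he]
  simp

theorem norm_hyperproj_le (e x : E) : ‖hyperproj e x‖ ≤ ‖x‖ :=
  Submodule.norm_orthogonalProjectionOnto_apply_le _ x

/-- The graph of `γ` in the direction `e`. -/
noncomputable def graphMap (e : E) (γ : hyperplane e → ℝ) (z : hyperplane e) : E :=
  (z : E) + γ z • e

theorem hyperproj_graphMap (γ : hyperplane e → ℝ) (z : hyperplane e) :
    hyperproj e (graphMap e γ z) = z := hyperproj_coe_add_smul z _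

theorem contDiff_graphMap {m : WithTop ℕ∞} {γ : hyperplane e → ℝ} (hγ : ContDiff ℝ m γ) :
    ContDiff ℝ m (graphMap e γ) :=
  (hyperplane e).subtypeL.contDiff.add (hγ.smul contDiff_const)

end Hyperplane

/-! ### Normals to a graph and the normal coordinate map -/

section NormalMap

variable {E : Type*} [NormedAddCommGroup E] [InnerProductSpace ℝ E] [CompleteSpace E]

/-- The non-normalised normal `e - ∇γ` to the graph of `γ`. -/
noncomputable def graphNormal (e : E) (γ : hyperplane e → ℝ) (z : hyperplane e) : E :=
  e - ((∇ γ z : hyperplane e) : E)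

/-- The unit normal to the graph of `γ`. -/
noncomputable def unitNormal (e : E) (γ : hyperplane e → ℝ) (z : hyperplane e) : E :=
  (‖graphNormal e γ z‖)⁻¹ • graphNormal e γ z

/-- The map `z + t e ↦ z + γ(z) e + t N(z)`, where `N` is the unit normal to the graph of `γ`. -/
noncomputable def normalMap (e : E) (γ : hyperplane e → ℝ) (x : E) : E :=
  graphMap e γ (hyperproj e x) + ⟪e, x⟫ • unitNormal e γ (hyperproj e x)

variable {e : E} {γ : hyperplane e → ℝ}

/-- This identifies `e - ∇γ` as the gradient of `x ↦ ⟪e, x⟫ - γ (hyperproj e x)`, the function whose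
sign tells the two sides of the graph apart. -/
theorem inner_graphNormal (z : hyperplane e) (x : E) :
    ⟪graphNormal e γ z, x⟫ = ⟪e, x⟫ - fderiv ℝ γ z (hyperproj e x) := by
  have : (fderiv ℝ γ z (hyperproj e x)) = ⟪∇ γ z, hyperproj e x⟫ := by
    rw [gradient, InnerProductSpace.toDual_symm_apply]
  rw [this, graphNormal, inner_sub_left, inner_coe_hyperproj]

theorem one_le_norm_graphNormal (he : ‖e‖ = 1) (z : hyperplane e) :
    1 ≤ ‖graphNormal e γ z‖ := by
  have h := inner_graphNormal (γ := γ) z e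
  rw [hyperproj_self, map_zero, sub_zero, real_inner_self_eq_norm_sq, he, one_pow] at h
  have := real_inner_le_norm (graphNormal e γ z) e
  rw [h, he, mul_one] at this
  exact this

theorem norm_unitNormal (he : ‖e‖ = 1) (z : hyperplane e) : ‖unitNormal e γ z‖ = 1 := by
  have := one_le_norm_graphNormal (γ := γ) he z
  rw [unitNormal, norm_smul, norm_inv, norm_norm, inv_mul_cancel₀ (by linarith)]

theorem inner_graphNormal_unitNormal (he : ‖e‖ = 1) (z : hyperplane e) :
    ⟪graphNormal e γ z, unitNormal e γ z⟫ = ‖graphNormal e γ z‖ := by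
  have := one_le_norm_graphNormal (γ := γ) he z
  rw [unitNormal, inner_smul_right, real_inner_self_eq_norm_sq]
  field_simp

theorem contDiff_graphNormal (hγ : ContDiff ℝ 2 γ) : ContDiff ℝ 1 (graphNormal e γ) := by
  have h1 : ContDiff ℝ 1 (fderiv ℝ γ) := hγ.fderiv_right (by norm_num)
  have h2 : ContDiff ℝ 1 (fun z => ∇ γ z) :=
    (InnerProductSpace.toDual ℝ (hyperplane e)).symm.toContinuousLinearEquiv.contDiff.comp h1
  exact contDiff_const.sub ((hyperplane e).subtypeL.contDiff.comp h2)

theorem contDiff_unitNormal (he : ‖e‖ = 1) (hγ : ContDiff ℝ 2 γ) :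
    ContDiff ℝ 1 (unitNormal e γ) := by
  have h := contDiff_graphNormal hγ
  have h0 : ∀ z, graphNormal e γ z ≠ 0 := fun z hz => by
    have := one_le_norm_graphNormal (γ := γ) he z
    rw [hz, norm_zero] at this; linarith
  exact ((h.norm ℝ h0).inv fun z => norm_ne_zero_iff.2 (h0 z)).smul h

theorem contDiff_normalMap (he : ‖e‖ = 1) (hγ : ContDiff ℝ 2 γ) :
    ContDiff ℝ 1 (normalMap e γ) :=
  ((contDiff_graphMap (hγ.of_le (by norm_num))).comp (hyperproj e).contDiff).add
    ((contDiff_const.inner ℝ contDiff_id).smul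
      ((contDiff_unitNormal he hγ).comp (hyperproj e).contDiff))

theorem normalMap_coe_add_smul (he : ‖e‖ = 1) (z : hyperplane e) (t : ℝ) :
    normalMap e γ ((z : E) + t • e) = graphMap e γ z + t • unitNormal e γ z := by
  rw [normalMap, hyperproj_coe_add_smul, inner_coe_add_smul he]

theorem normalMap_coe (z : hyperplane e) : normalMap e γ (z : E) = graphMap e γ z := by
  rw [normalMap, hyperproj_coe, inner_coe_hyperplane, zero_smul, add_zero]

/-- The derivative of `normalMap` at a point of the hyperplane is invertible. -/
theorem det_fderiv_normalMap_ne_zero [FiniteDimensional ℝ E] (he : ‖e‖ = 1) (hγ : ContDiff ℝ 2 γ) (z : hyperplane e) :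
    (fderiv ℝ (normalMap e γ) (z : E)).det ≠ 0 := by
  have hγ' : HasFDerivAt γ (fderiv ℝ γ z) (hyperproj e (z : E)) := by
    rw [hyperproj_coe]; exact (hγ.differentiable (by norm_num) z).hasFDerivAt
  have hN : HasFDerivAt (unitNormal e γ) (fderiv ℝ (unitNormal e γ) z) (hyperproj e (z : E)) := by
    rw [hyperproj_coe]
    exact ((contDiff_unitNormal he hγ).differentiable (by norm_num) z).hasFDerivAt
  have hP := (hyperproj e).hasFDerivAt (x := (z : E))
  have hi := (innerSL ℝ e).hasFDerivAt (x := (z : E))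
  have h1 := ((hyperplane e).subtypeL.hasFDerivAt.comp (z : E) hP).add
    ((hγ'.comp (z : E) hP).smul_const e)
  have h2 := h1.add (hi.smul (hN.comp (z : E) hP))
  have h3 : HasFDerivAt (normalMap e γ) _ (z : E) := h2
  rw [h3.fderiv]
  intro h0
  obtain ⟨v, hv, hv0⟩ := (Submodule.ne_bot_iff _).1
    (LinearMap.bot_lt_ker_of_det_eq_zero (f := (_ : E →ₗ[ℝ] E)) h0).ne'
  rw [LinearMap.mem_ker] at hv
  have hv' : (hyperproj e v : E) + fderiv ℝ γ z (hyperproj e v) • e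
      + ⟪e, v⟫ • unitNormal e γ z = 0 := by
    simpa [inner_coe_hyperplane, hyperproj_coe] using hv
  -- A kernel vector is split into a part tangent to the graph and a multiple of the normal. Pairing
  -- with the normal kills the first, so the coefficient `⟪e, v⟫` vanishes; projecting back then
  -- kills the tangential part.
  have hT : ⟪graphNormal e γ z, (hyperproj e v : E) + fderiv ℝ γ z (hyperproj e v) • e⟫ = 0 := by
    rw [inner_graphNormal, hyperproj_coe_add_smul, inner_coe_add_smul he, sub_self]
  have h4 := congrArg (fun w => ⟪graphNormal e γ z, w⟫) hv'
  simp only [inner_zero_right] at h4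
  rw [inner_add_right, hT, inner_smul_right, inner_graphNormal_unitNormal he, zero_add] at h4
  have h5 : ⟪e, v⟫ = 0 := by
    have := one_le_norm_graphNormal (γ := γ) he z
    rcases mul_eq_zero.1 h4 with h | h
    · exact h
    · linarith
  rw [h5, zero_smul, add_zero] at hv'
  have h6 := congrArg (hyperproj e) hv'
  rw [hyperproj_coe_add_smul, map_zero] at h6
  apply hv0
  rw [← hyperproj_add_inner_smul he v, h5, h6]
  simp

end NormalMap

/-! ### Nearest points on a graph, and its two sides -/

section LocalGraph

variable {E : Type*} [NormedAddCommGroup E] [InnerProductSpace ℝ E]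
  {e : E} {γ : hyperplane e → ℝ}

theorem graphMap_hyperproj (he : ‖e‖ = 1) {x : E} (hx : γ (hyperproj e x) = ⟪e, x⟫) :
    graphMap e γ (hyperproj e x) = x := by
  rw [graphMap, hx, hyperproj_add_inner_smul he]

variable [CompleteSpace E]

/-- A point nearest to `x` on a piece of the graph of `γ` lies on the normal line through `x`. -/
theorem sub_graphMap_eq_smul_graphNormal (he : ‖e‖ = 1) (hγ : ContDiff ℝ 2 γ) {x : E}
    {z : hyperplane e} (h : IsLocalMin (fun w => ‖x - graphMap e γ w‖ ^ 2) z) :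
    x - graphMap e γ z = ⟪e, x - graphMap e γ z⟫ • graphNormal e γ z := by
  have hγ' : HasFDerivAt γ (fderiv ℝ γ z) z := (hγ.differentiable (by norm_num) z).hasFDerivAt
  have hg : HasFDerivAt (graphMap e γ)
      ((hyperplane e).subtypeL + (fderiv ℝ γ z).smulRight e) z :=
    (hyperplane e).subtypeL.hasFDerivAt.add (hγ'.smul_const e)
  have h1 := h.hasFDerivAt_eq_zero (hg.const_sub x).norm_sq
  set w := x - graphMap e γ z with hw
  have h2 : ∀ v : hyperplane e, ⟪w, (v : E)⟫ + fderiv ℝ γ z v * ⟪e, w⟫ = 0 := fun v => by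
    have := DFunLike.congr_fun h1 v
    simp at this
    rw [real_inner_comm w e]
    linarith
  -- The defect `d` from the claimed identity is orthogonal to `e`, hence an admissible direction in
  -- the hyperplane; the criticality condition `h2` in that direction says `⟪d, d⟫ = 0`.
  set d := w - ⟪e, w⟫ • graphNormal e γ z with hd
  have hee : ⟪e, e⟫ = 1 := by rw [real_inner_self_eq_norm_sq, he, one_pow]
  have hed : ⟪e, d⟫ = 0 := by
    rw [hd, inner_sub_right, inner_smul_right, real_inner_comm (graphNormal e γ z) e,
      inner_graphNormal, hyperproj_self, map_zero, hee]
    ring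
  have hPd : (hyperproj e d : E) = d := by
    have := hyperproj_add_inner_smul he d
    rwa [hed, zero_smul, add_zero] at this
  have hdd : ⟪d, d⟫ = 0 := by
    nth_rw 2 [← hPd]
    rw [hd, inner_sub_left, inner_smul_left, inner_graphNormal, ← hd, inner_coe_hyperplane,
      hyperproj_coe]
    have := h2 (hyperproj e d)
    simp only [conj_trivial]
    linarith
  have := inner_self_eq_zero.1 hdd
  exact sub_eq_zero.1 this

/-- The normal map carries the two sides of the hyperplane to the two sides of the graph. -/
theorem eventually_inner_pos_iff_normalMap (he : ‖e‖ = 1) (hγ : ContDiff ℝ 2 γ)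
    (z₀ : hyperplane e) :
    ∀ᶠ ζ in 𝓝 (z₀ : E), 0 < ⟪e, ζ⟫ ↔
      γ (hyperproj e (normalMap e γ ζ)) < ⟪e, normalMap e γ ζ⟫ := by
  set H : E → ℝ := fun x => ⟪e, x⟫ - γ (hyperproj e x) with hH
  have hH1 : ContDiff ℝ 1 H := (contDiff_const.inner ℝ contDiff_id).sub
    ((hγ.of_le (by norm_num)).comp (hyperproj e).contDiff)
  set y₀ := graphMap e γ z₀
  have hPy : hyperproj e y₀ = z₀ := hyperproj_graphMap γ z₀
  have hD : HasFDerivAt H (innerSL ℝ (graphNormal e γ z₀)) y₀ := by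
    have hγ' : HasFDerivAt γ (fderiv ℝ γ z₀) (hyperproj e y₀) := by
      rw [hPy]; exact (hγ.differentiable (by norm_num) z₀).hasFDerivAt
    have h := (innerSL ℝ e).hasFDerivAt (x := y₀) |>.sub
      (hγ'.comp y₀ (hyperproj e).hasFDerivAt)
    refine h.congr_fderiv (ContinuousLinearMap.ext fun v => ?_)
    simp [inner_graphNormal]
  -- Strict differentiability is needed because `H` is compared at two moving points, `normalMap e γ
  -- ζ` and its foot on the graph.
  have hS : HasStrictFDerivAt H (innerSL ℝ (graphNormal e γ z₀)) y₀ :=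
    hH1.contDiffAt.hasStrictFDerivAt' hD (by norm_num)
  -- With `t = ⟪e, ζ⟫`, the linear part of `H` is `t` times a number above `1/2`, and the error is
  -- at most `|t|/4`; so `H` has the sign of `t`.
  have hlit := hS.isLittleO.bound (show (0 : ℝ) < 1 / 4 by norm_num)
  have hg : Continuous (graphMap e γ) := (contDiff_graphMap hγ).continuous
  have hΦ : Continuous (normalMap e γ) := (contDiff_normalMap he hγ).continuous
  have ht : Tendsto (fun ζ : E => (normalMap e γ ζ, graphMap e γ (hyperproj e ζ))) (𝓝 (z₀ : E))
      (𝓝 (y₀, y₀)) := by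
    have hc : Continuous (fun ζ : E => (normalMap e γ ζ, graphMap e γ (hyperproj e ζ))) :=
      hΦ.prodMk (hg.comp (hyperproj e).continuous)
    have := hc.tendsto (z₀ : E)
    rwa [normalMap_coe, hyperproj_coe] at this
  have hN : ∀ᶠ ζ in 𝓝 (z₀ : E),
      1 / 2 < ⟪graphNormal e γ z₀, unitNormal e γ (hyperproj e ζ)⟫ := by
    have hc : Continuous fun ζ : E => ⟪graphNormal e γ z₀, unitNormal e γ (hyperproj e ζ)⟫ :=
      continuous_const.inner ((contDiff_unitNormal he hγ).continuous.comp (hyperproj e).continuous)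
    refine hc.continuousAt.eventually_const_lt ?_
    simp only [hyperproj_coe, inner_graphNormal_unitNormal he]
    have := one_le_norm_graphNormal (γ := γ) he z₀
    linarith
  filter_upwards [ht.eventually hlit, hN] with ζ h1 h2
  have hdiff : normalMap e γ ζ - graphMap e γ (hyperproj e ζ)
      = ⟪e, ζ⟫ • unitNormal e γ (hyperproj e ζ) := by
    rw [normalMap, add_sub_cancel_left]
  have hHg : H (graphMap e γ (hyperproj e ζ)) = 0 := by
    simp only [hH]
    rw [hyperproj_graphMap, graphMap, inner_coe_add_smul he, sub_self]
  simp only [hdiff, hHg, innerSL_apply_apply, inner_smul_right, norm_smul, norm_unitNormal he,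
    sub_zero, mul_one] at h1
  have h3 : H (normalMap e γ ζ) =
    ⟪e, normalMap e γ ζ⟫ - γ (hyperproj e (normalMap e γ ζ)) := rfl
  rw [Real.norm_eq_abs, Real.norm_eq_abs, abs_le] at h1
  rw [← sub_pos (b := γ _), ← h3]
  constructor
  · intro hpos
    rw [abs_of_pos hpos] at h1
    nlinarith
  · intro hpos
    by_contra hneg
    push Not at hneg
    rw [abs_of_nonpos hneg] at h1
    nlinarith

end LocalGraph

/-! ### Normal charts at a `C²` boundary point -/

section Chart

variable {n : ℕ} {Ω : Set (EuclideanSpace ℝ (Fin n))}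

/-- Local description of the boundary of `Ω` as the graph of `γ` in the direction `e`. -/
theorem mem_frontier_iff_of_graph {e : EuclideanSpace ℝ (Fin n)} (he : ‖e‖ = 1)
    {γ : hyperplane e → ℝ} (hγ : Continuous γ) {y₀ : EuclideanSpace ℝ (Fin n)} {r : ℝ}
    (hΩ : IsOpen Ω) (h : ∀ x ∈ Metric.ball y₀ r, (x ∈ Ω ↔ γ (hyperproj e x) < ⟪e, x⟫))
    {x : EuclideanSpace ℝ (Fin n)} (hx : x ∈ Metric.ball y₀ r) :
    x ∈ frontier Ω ↔ γ (hyperproj e x) = ⟪e, x⟫ := by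
  have hγP : Continuous fun x => γ (hyperproj e x) := hγ.comp (hyperproj e).continuous
  have hi : Continuous fun x : EuclideanSpace ℝ (Fin n) => ⟪e, x⟫ :=
    continuous_const.inner continuous_id
  rw [hΩ.frontier_eq, Set.mem_sdiff, h x hx, not_lt]
  constructor
  · rintro ⟨hcl, hle⟩
    refine le_antisymm ?_ hle
    by_contra hlt
    push Not at hlt
    obtain ⟨w, ⟨hw1, hw2⟩, hw3⟩ := mem_closure_iff_nhds.1 hcl _
      (Filter.inter_mem (Metric.isOpen_ball.mem_nhds hx)
        ((isOpen_lt hi hγP).mem_nhds hlt))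
    exact lt_asymm ((h w hw1).1 hw3) hw2
  · intro heq
    refine ⟨?_, heq.ge⟩
    have hc : Continuous fun s : ℝ => x + s • e := by fun_prop
    have ht : Tendsto (fun s : ℝ => x + s • e) (𝓝[>] 0) (𝓝 x) := by
      have := hc.tendsto 0
      simp only [zero_smul, add_zero] at this
      exact this.mono_left nhdsWithin_le_nhds
    refine mem_closure_of_tendsto ht ?_
    filter_upwards [ht (Metric.isOpen_ball.mem_nhds hx), self_mem_nhdsWithin] with s hs hs0
    rw [h _ hs, map_add, map_smul, hyperproj_self, smul_zero, add_zero, heq, inner_add_right,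
      inner_smul_right, real_inner_self_eq_norm_sq, he]
    simpa using hs0

/-- Normal coordinates `ζ = z + t e ↦ Φ(ζ) = g(z) + t N(z)` near a boundary point `y₀` of `Ω`, with
`z` in the hyperplane orthogonal to `e`, `g` a local parametrisation of `∂Ω` and `N` the inner unit
normal. -/
structure NormalChart (Ω : Set (EuclideanSpace ℝ (Fin n))) (y₀ : EuclideanSpace ℝ (Fin n)) where
  e : EuclideanSpace ℝ (Fin n)
  norm_e : ‖e‖ = 1
  g : hyperplane e → EuclideanSpace ℝ (Fin n)
  contDiff_g : ContDiff ℝ 1 g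
  hyperproj_g : ∀ z, hyperproj e (g z) = z
  Φ : OpenPartialHomeomorph (EuclideanSpace ℝ (Fin n)) (EuclideanSpace ℝ (Fin n))
  radius : ℝ
  radius_pos : 0 < radius
  source_eq : Φ.source = Metric.ball (hyperproj e y₀ : EuclideanSpace ℝ (Fin n)) radius
  contDiff : ContDiff ℝ 1 Φ
  contDiffAt_symm : ∀ x ∈ Φ.target, ContDiffAt ℝ 1 Φ.symm x
  detLower : ℝ≥0
  detUpper : ℝ≥0
  detLower_pos : 0 < detLower
  detLower_le : ∀ ζ ∈ Φ.source, (detLower : ℝ) ≤ |(fderiv ℝ Φ ζ).det|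
  le_detUpper : ∀ ζ ∈ Φ.source, |(fderiv ℝ Φ ζ).det| ≤ detUpper
  symmBound : ℝ
  norm_fderiv_symm_le : ∀ x ∈ Φ.target, ‖fderiv ℝ Φ.symm x‖ ≤ symmBound
  mem_iff : ∀ ζ ∈ Φ.source, Φ ζ ∈ Ω ↔ 0 < ⟪e, ζ⟫
  bdryDist_eq : ∀ ζ ∈ Φ.source, 0 < ⟪e, ζ⟫ → bdryDist Ω (Φ ζ) = ⟪e, ζ⟫
  notMem_singularSet : ∀ ζ ∈ Φ.source, Φ ζ ∉ singularSet Ω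
  nearestPoint_eq : ∀ ζ ∈ Φ.source, nearestPoint Ω (Φ ζ) = g (hyperproj e ζ)
  g_mem_frontier : ∀ z ∈ Metric.ball (hyperproj e y₀) radius, g z ∈ frontier Ω
  eventually_eq_g : ∀ᶠ y in 𝓝 y₀, y ∈ frontier Ω → g (hyperproj e y) = y

/-- The inverse function theorem makes the normal map a local diffeomorphism. A nearest boundary
point to `x` has `x` on its normal line, which yields normal coordinates for `x`; injectivity makes
them the given ones, so the nearest point is unique and the normal coordinate is the signed
distance. -/
theorem HasC2Boundary.nonempty_normalChart (hΩ : IsOpen Ω) (hC2 : HasC2Boundary Ω)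
    {y₀ : EuclideanSpace ℝ (Fin n)} (hy₀ : y₀ ∈ frontier Ω) : Nonempty (NormalChart Ω y₀) := by
  obtain ⟨e, he, γ, hγ, r, hr, hgraph⟩ := hC2 y₀ hy₀
  have hfr := fun x (hx : x ∈ Metric.ball y₀ r) =>
    mem_frontier_iff_of_graph he hγ.continuous hΩ hgraph hx
  set z₀ := hyperproj e y₀ with hz₀
  have hgy : graphMap e γ z₀ = y₀ :=
    graphMap_hyperproj he ((hfr y₀ (Metric.mem_ball_self hr)).1 hy₀)
  have hgc : Continuous (graphMap e γ) := (contDiff_graphMap hγ).continuous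
  have hΦ1 := contDiff_normalMap he hγ
  have hΦz : normalMap e γ z₀ = y₀ := by rw [normalMap_coe, hgy]
  have hdet := det_fderiv_normalMap_ne_zero he hγ z₀
  have hfd : HasFDerivAt (normalMap e γ)
      ((ContinuousLinearMap.toContinuousLinearEquivOfDetNeZero _ hdet :
        EuclideanSpace ℝ (Fin n) ≃L[ℝ] EuclideanSpace ℝ (Fin n)) :
        EuclideanSpace ℝ (Fin n) →L[ℝ] EuclideanSpace ℝ (Fin n)) (z₀ : EuclideanSpace ℝ (Fin n)) := by
    rw [ContinuousLinearMap.coe_toContinuousLinearEquivOfDetNeZero]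
    exact (hΦ1.differentiable (by norm_num) _).hasFDerivAt
  set Ψ := hΦ1.contDiffAt.toOpenPartialHomeomorph (normalMap e γ) hfd (by norm_num) with hΨ
  have hΨc : (Ψ : EuclideanSpace ℝ (Fin n) → EuclideanSpace ℝ (Fin n)) = normalMap e γ := rfl
  have hz₀s : (z₀ : EuclideanSpace ℝ (Fin n)) ∈ Ψ.source :=
    hΦ1.contDiffAt.mem_toOpenPartialHomeomorph_source hfd (by norm_num)
  have hsymm : ContDiffAt ℝ 1 Ψ.symm y₀ := by
    have := hΦ1.contDiffAt.to_localInverse hfd (by norm_num)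
    rwa [hΦz] at this
  obtain ⟨ρ₀, hρ₀, hball₀⟩ := Metric.isOpen_iff.1 Ψ.open_source _ hz₀s
  have hΦcont : Tendsto (normalMap e γ) (𝓝 (z₀ : EuclideanSpace ℝ (Fin n))) (𝓝 y₀) := by
    have := hΦ1.continuous.tendsto (z₀ : EuclideanSpace ℝ (Fin n))
    rwa [hΦz] at this
  have hsymm_ev : ∀ᶠ x in 𝓝 y₀, ContDiffAt ℝ 1 Ψ.symm x := hsymm.eventually (by norm_num)
  have hsymm_bd : ∀ᶠ x in 𝓝 y₀, ‖fderiv ℝ Ψ.symm x‖ < ‖fderiv ℝ Ψ.symm y₀‖ + 1 := by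
    have hc : ContinuousAt (fderiv ℝ Ψ.symm) y₀ :=
      (hsymm.fderiv_right (m := 0) (by norm_num)).continuousAt
    exact hc.norm.eventually_lt_const (lt_add_one _)
  set d₀ := |(fderiv ℝ (normalMap e γ) (z₀ : EuclideanSpace ℝ (Fin n))).det| with hd₀
  have hd₀pos : 0 < d₀ := abs_pos.2 hdet
  have hdc : Continuous fun ζ => |(fderiv ℝ (normalMap e γ) ζ).det| :=
    (ContinuousLinearMap.continuous_det.comp (hΦ1.continuous_fderiv (by norm_num))).abs
  have hd1 : ∀ᶠ ζ in 𝓝 (z₀ : EuclideanSpace ℝ (Fin n)),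
      d₀ / 2 < |(fderiv ℝ (normalMap e γ) ζ).det| :=
    hdc.continuousAt.eventually_const_lt (half_lt_self hd₀pos)
  have hd2 : ∀ᶠ ζ in 𝓝 (z₀ : EuclideanSpace ℝ (Fin n)),
      |(fderiv ℝ (normalMap e γ) ζ).det| < 2 * d₀ :=
    hdc.continuousAt.eventually_lt_const (by linarith)
  have hgr : ∀ᶠ ζ in 𝓝 (z₀ : EuclideanSpace ℝ (Fin n)),
      graphMap e γ (hyperproj e ζ) ∈ Metric.ball y₀ r := by
    have hc : Continuous fun ζ : EuclideanSpace ℝ (Fin n) => graphMap e γ (hyperproj e ζ) :=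
      hgc.comp (hyperproj e).continuous
    refine hc.continuousAt.eventually (Metric.isOpen_ball.mem_nhds ?_)
    simp only [hyperproj_coe, hgy]
    exact Metric.mem_ball_self hr
  -- If `x` is this close to `y₀`, a nearest point `y` has `|y - y₀| ≤ 2|x - y₀| < r`, so it lies on
  -- the graph. Its coordinates `ζ'` satisfy `|ζ' - z₀| ≤ |y - y₀| + |x - y| ≤ 3|x - y₀| < ρ₀`, so
  -- they lie where `Ψ` is injective.
  have hnear := hΦcont.eventually
    (Metric.ball_mem_nhds y₀ (show (0 : ℝ) < min (r / 2) (ρ₀ / 3) by positivity))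
  obtain ⟨ρ, hρ, hρball⟩ := Metric.eventually_nhds_iff_ball.1
    ((Ψ.open_source.eventually_mem hz₀s).and <| (hΦcont.eventually hsymm_ev).and <|
      (hΦcont.eventually hsymm_bd).and <| hd1.and <| hd2.and <| hgr.and <| hnear.and
        (eventually_inner_pos_iff_normalMap he hγ z₀))
  choose a1 a2 a3 a4 a5 a6 a7 a8 using hρball
  have hsrc : (Ψ.restrOpen (Metric.ball (z₀ : EuclideanSpace ℝ (Fin n)) ρ)
      Metric.isOpen_ball).source = Metric.ball (z₀ : EuclideanSpace ℝ (Fin n)) ρ := by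
    rw [OpenPartialHomeomorph.restrOpen_source]
    exact inter_eq_right.2 fun ζ hζ => a1 ζ hζ
  have htgt : ∀ x ∈ (Ψ.restrOpen (Metric.ball (z₀ : EuclideanSpace ℝ (Fin n)) ρ)
      Metric.isOpen_ball).target, ∃ ζ ∈ Metric.ball (z₀ : EuclideanSpace ℝ (Fin n)) ρ,
      normalMap e γ ζ = x := fun x hx => by
    refine ⟨Ψ.symm x, ?_, ?_⟩
    · rw [← hsrc]; exact OpenPartialHomeomorph.map_target _ hx
    · exact OpenPartialHomeomorph.right_inv _ hx
  have hkey : ∀ ζ ∈ Metric.ball (z₀ : EuclideanSpace ℝ (Fin n)) ρ, ∀ y ∈ frontier Ω,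
      dist (normalMap e γ ζ) y = bdryDist Ω (normalMap e γ ζ) →
      y = graphMap e γ (hyperproj e ζ) ∧ bdryDist Ω (normalMap e γ ζ) = |⟪e, ζ⟫| := by
    intro ζ hζ y hy hdist
    set x := normalMap e γ ζ with hx
    have hxd : dist x y₀ < min (r / 2) (ρ₀ / 3) := a7 ζ hζ
    have hx1 := hxd.trans_le (min_le_left _ _)
    have hx2 := hxd.trans_le (min_le_right _ _)
    have hdle : dist x y ≤ dist x y₀ := by
      rw [hdist]; exact Metric.infDist_le_dist_of_mem hy₀
    have hyy : dist y y₀ < r := by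
      have := dist_triangle_left y y₀ x
      linarith
    have hgy' : graphMap e γ (hyperproj e y) = y := graphMap_hyperproj he ((hfr y hyy).1 hy)
    have hmin : IsLocalMin (fun w => ‖x - graphMap e γ w‖ ^ 2) (hyperproj e y) := by
      have : ∀ᶠ w in 𝓝 (hyperproj e y), graphMap e γ w ∈ Metric.ball y₀ r := by
        refine hgc.continuousAt.eventually (Metric.isOpen_ball.mem_nhds ?_)
        rw [hgy']; exact hyy
      filter_upwards [this] with w hw
      have hwf : graphMap e γ w ∈ frontier Ω := by
        rw [hfr _ hw, hyperproj_graphMap, graphMap, inner_coe_add_smul he]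
      have h1 : dist x y ≤ dist x (graphMap e γ w) := by
        rw [hdist]; exact Metric.infDist_le_dist_of_mem hwf
      rw [dist_eq_norm, dist_eq_norm] at h1
      simp only [hgy']
      gcongr
    have hn := sub_graphMap_eq_smul_graphNormal he hγ hmin
    rw [hgy'] at hn
    set t := ⟪e, x - y⟫ * ‖graphNormal e γ (hyperproj e y)‖ with ht
    have hge := one_le_norm_graphNormal (γ := γ) he (hyperproj e y)
    have hxy : x - y = t • unitNormal e γ (hyperproj e y) := by
      rw [ht, unitNormal, smul_smul, mul_assoc, mul_inv_cancel₀ (by linarith), mul_one]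
      exact hn
    have htd : |t| = dist x y := by
      rw [dist_eq_norm, hxy, norm_smul, norm_unitNormal he, mul_one, Real.norm_eq_abs]
    set ζ' : EuclideanSpace ℝ (Fin n) := (hyperproj e y : EuclideanSpace ℝ (Fin n)) + t • e with hζ'
    have hΦζ' : normalMap e γ ζ' = x := by
      rw [hζ', normalMap_coe_add_smul he, hgy', ← hxy]; abel
    have hζ's : ζ' ∈ Ψ.source := by
      apply hball₀
      rw [Metric.mem_ball, dist_eq_norm]
      have e1 : ζ' - (z₀ : EuclideanSpace ℝ (Fin n))
          = (hyperproj e (y - y₀) : EuclideanSpace ℝ (Fin n)) + t • e := by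
        rw [hζ', hz₀, map_sub, Submodule.coe_sub]; abel
      have e2 : ‖ζ' - (z₀ : EuclideanSpace ℝ (Fin n))‖ ≤ ‖y - y₀‖ + |t| := by
        rw [e1]
        refine (norm_add_le _ _).trans (add_le_add (norm_hyperproj_le e _) ?_)
        rw [norm_smul, he, mul_one, Real.norm_eq_abs]
      have e3 := dist_triangle_left y y₀ x
      rw [← dist_eq_norm y y₀] at e2
      linarith
    have hζζ' : ζ = ζ' := Ψ.injOn (a1 ζ hζ) hζ's (by rw [hΨc, hΦζ'])
    constructor
    · rw [hζζ', hζ', hyperproj_coe_add_smul, hgy']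
    · rw [← hdist, ← htd, hζζ', hζ', inner_coe_add_smul he]
  have hex : ∀ x, ∃ y ∈ frontier Ω, dist x y = bdryDist Ω x := fun x => by
    obtain ⟨y, hy, hxy⟩ := isClosed_frontier.exists_infDist_eq_dist ⟨y₀, hy₀⟩ x
    exact ⟨y, hy, hxy.symm⟩
  have hbd : ∀ ζ ∈ Metric.ball (z₀ : EuclideanSpace ℝ (Fin n)) ρ,
      bdryDist Ω (normalMap e γ ζ) = |⟪e, ζ⟫| := fun ζ hζ => by
    obtain ⟨y, hy, hxy⟩ := hex (normalMap e γ ζ)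
    exact (hkey ζ hζ y hy hxy).2
  have hΩiff : ∀ ζ ∈ Metric.ball (z₀ : EuclideanSpace ℝ (Fin n)) ρ,
      (normalMap e γ ζ ∈ Ω ↔ 0 < ⟪e, ζ⟫) := fun ζ hζ => by
    rw [a8 ζ hζ, hgraph]
    refine Metric.ball_subset_ball ?_ (a7 ζ hζ)
    exact (min_le_left _ _).trans (by linarith)
  refine ⟨{
    e := e
    norm_e := he
    g := graphMap e γ
    contDiff_g := (contDiff_graphMap hγ).of_le (by norm_num)
    hyperproj_g := hyperproj_graphMap γ
    Φ := Ψ.restrOpen (Metric.ball (z₀ : EuclideanSpace ℝ (Fin n)) ρ) Metric.isOpen_ball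
    radius := ρ
    radius_pos := hρ
    source_eq := hsrc
    contDiff := hΦ1
    contDiffAt_symm := ?_
    detLower := (d₀ / 2).toNNReal
    detUpper := (2 * d₀).toNNReal
    detLower_pos := by simpa using hd₀pos
    detLower_le := ?_
    le_detUpper := ?_
    symmBound := ‖fderiv ℝ Ψ.symm y₀‖ + 1
    norm_fderiv_symm_le := ?_
    mem_iff := ?_
    bdryDist_eq := ?_
    notMem_singularSet := ?_
    nearestPoint_eq := ?_
    g_mem_frontier := ?_
    eventually_eq_g := ?_ }⟩
  · intro x hx
    obtain ⟨ζ, hζ, rfl⟩ := htgt x hx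
    exact a2 ζ hζ
  · intro ζ hζ
    rw [hsrc] at hζ
    rw [Real.coe_toNNReal _ (by positivity)]
    exact (a4 ζ hζ).le
  · intro ζ hζ
    rw [hsrc] at hζ
    rw [Real.coe_toNNReal _ (by positivity)]
    exact (a5 ζ hζ).le
  · intro x hx
    obtain ⟨ζ, hζ, rfl⟩ := htgt x hx
    exact (a3 ζ hζ).le
  · intro ζ hζ
    rw [hsrc] at hζ
    exact hΩiff ζ hζ
  · intro ζ hζ hpos
    rw [hsrc] at hζ
    rw [← abs_of_pos hpos]
    exact hbd ζ hζ
  · intro ζ hζ hs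
    rw [hsrc] at hζ
    obtain ⟨-, y₁, hy₁, y₂, hy₂, hne, h1, h2⟩ := hs
    exact hne ((hkey ζ hζ y₁ hy₁ h1).1.trans (hkey ζ hζ y₂ hy₂ h2).1.symm)
  · intro ζ hζ
    rw [hsrc] at hζ
    obtain ⟨y, hy, hxy⟩ := hex (normalMap e γ ζ)
    have hs := Classical.epsilon_spec
      (p := fun y => y ∈ frontier Ω ∧ dist (normalMap e γ ζ) y = bdryDist Ω (normalMap e γ ζ))
      ⟨y, hy, hxy⟩
    exact (hkey ζ hζ _ hs.1 hs.2).1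
  · intro z hz
    have hz' : (z : EuclideanSpace ℝ (Fin n)) ∈
        Metric.ball (z₀ : EuclideanSpace ℝ (Fin n)) ρ := hz
    have := a6 z hz'
    rw [hyperproj_coe] at this
    rw [hfr _ this, hyperproj_graphMap, graphMap, inner_coe_add_smul he]
  · filter_upwards [Metric.ball_mem_nhds y₀ hr] with y hy hyf
    exact graphMap_hyperproj he ((hfr y hy).1 hyf)

end Chart

/-! ### Compactly supported `C¹` functions as competitors -/

section TestFunctions

variable {n : ℕ} {p : ℝ} {Ω Γ : Set (EuclideanSpace ℝ (Fin n))}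
  {σ : EuclideanSpace ℝ (Fin n) → ℝ≥0∞} {u : EuclideanSpace ℝ (Fin n) → ℝ}

theorem inner_gradient (u : EuclideanSpace ℝ (Fin n) → ℝ) (x v : EuclideanSpace ℝ (Fin n)) :
    ⟪∇ u x, v⟫ = fderiv ℝ u x v := by
  rw [gradient, InnerProductSpace.toDual_symm_apply]

theorem enorm_gradient (u : EuclideanSpace ℝ (Fin n) → ℝ) (x : EuclideanSpace ℝ (Fin n)) :
    ‖∇ u x‖ₑ = ‖fderiv ℝ u x‖ₑ := by
  rw [gradient, LinearIsometryEquiv.enorm_map]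

theorem continuous_gradient (hu : ContDiff ℝ 1 u) : Continuous fun x => ∇ u x :=
  (InnerProductSpace.toDual ℝ (EuclideanSpace ℝ (Fin n))).symm.continuous.comp
    (hu.continuous_fderiv (by norm_num))

theorem hasCompactSupport_gradient (hc : HasCompactSupport u) :
    HasCompactSupport fun x => ∇ u x :=
  (hc.fderiv (𝕜 := ℝ)).comp_left (map_zero (InnerProductSpace.toDual ℝ _).symm)

/-- Both integrands vanish off `Ω`, so this is integration by parts on the whole space, without
boundary terms. -/
theorem isWeakGradient_gradient (hu : ContDiff ℝ 1 u) (hc : HasCompactSupport u)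
    (hs : tsupport u ⊆ Ω) : IsWeakGradient Ω u fun x => ∇ u x := by
  intro η hη hηc _ v
  have hη1 : ContDiff ℝ 1 η := hη.of_le (by exact_mod_cast le_top)
  have hu0 : ∀ x, x ∉ Ω → u x = 0 := fun x hx => image_eq_zero_of_notMem_tsupport fun h => hx (hs h)
  have hg0 : ∀ x, x ∉ Ω → fderiv ℝ u x = 0 := fun x hx => by
    by_contra h
    exact hx (hs (support_fderiv_subset ℝ h))
  simp only [inner_gradient]
  rw [setIntegral_eq_integral_of_forall_compl_eq_zero fun x hx => by rw [hu0 x hx, zero_mul],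
    setIntegral_eq_integral_of_forall_compl_eq_zero fun x hx => by rw [hg0 x hx]; simp]
  have hfu : Continuous fun x => fderiv ℝ u x v :=
    (hu.continuous_fderiv (by norm_num)).clm_apply continuous_const
  have hfη : Continuous fun x => fderiv ℝ η x v :=
    (hη1.continuous_fderiv (by norm_num)).clm_apply continuous_const
  have := integral_mul_fderiv_eq_neg_fderiv_mul_of_integrable (μ := volume) (f := u) (g := η)
    (v := v) ((hfu.mul hη1.continuous).integrable_of_hasCompactSupport hηc.mul_left)
    ((hu.continuous.mul hfη).integrable_of_hasCompactSupport hc.mul_right)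
    ((hu.continuous.mul hη1.continuous).integrable_of_hasCompactSupport hc.mul_right)
    (fun x _ => hu.differentiable (by norm_num) x) (fun x _ => hη1.differentiable (by norm_num) x)
  rw [this]
  simp only [mul_comm]

theorem eq_zero_of_mem_frontier (hΩ : IsOpen Ω) (hs : tsupport u ⊆ Ω)
    {y : EuclideanSpace ℝ (Fin n)} (hy : y ∈ frontier Ω) : u y = 0 := by
  refine image_eq_zero_of_notMem_tsupport fun h => ?_
  rw [hΩ.frontier_eq] at hy
  exact hy.2 (hs h)

/-- Functions of class `C¹` with compact support in `Ω` are admissible in the definition of the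
Hardy constant, and have trace zero. -/
theorem hardyConstant_le_of_contDiff (hp : 1 < p) (hΩ : IsOpen Ω) (hΓ : Γ ⊆ frontier Ω)
    (hu : ContDiff ℝ 1 u) (hc : HasCompactSupport u) (hs : tsupport u ⊆ Ω)
    (h0 : weightedNormPow p Ω σ u ≠ 0) (htop : weightedNormPow p Ω σ u ≠ ∞) :
    hardyConstant p Ω Γ σ ≤
      (∫⁻ x in Ω, ‖fderiv ℝ u x‖ₑ ^ p) / weightedNormPow p Ω σ u := by
  have hW : MemW1p p Ω u fun x => ∇ u x :=
    ⟨(hu.continuous.memLp_of_hasCompactSupport hc).restrict _,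
      ((continuous_gradient hu).memLp_of_hasCompactSupport
        (hasCompactSupport_gradient hc)).restrict _,
      isWeakGradient_gradient hu hc hs⟩
  have hC1 : IsC1UpToBoundary Ω u :=
    ⟨hu.continuous.continuousOn, (hu.differentiable (by norm_num)).differentiableOn,
      fun x => ∇ u x, (continuous_gradient hu).continuousOn, fun x _ => rfl⟩
  -- The constant sequence `u` serves both for membership in the closure and for the trace, since
  -- `u` vanishes on `∂Ω`.
  have hT : TendstoW1p p Ω (fun _ => u) u fun x => ∇ u x := by
    constructor <;> simp
  have hZ : MemW1pZero p Ω Γ u fun x => ∇ u x :=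
    ⟨hW, fun _ => u, fun _ => ⟨hC1, fun y hy => eq_zero_of_mem_frontier hΩ hs (hΓ hy)⟩, hT⟩
  have htr : IsTrace p Ω u (fun x => ∇ u x) 0 := by
    refine ⟨MemLp.zero', fun _ => u, fun _ => hC1, hT, ?_⟩
    have : eLpNorm (fun y => u y - (0 : EuclideanSpace ℝ (Fin n) → ℝ) y) (ENNReal.ofReal p)
        (surfaceMeasure Ω) = 0 := by
      rw [← eLpNorm_zero (ε := ℝ) (p := ENNReal.ofReal p) (μ := surfaceMeasure Ω)]
      refine eLpNorm_congr_ae ?_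
      filter_upwards [ae_restrict_mem isClosed_frontier.measurableSet] with y hy
      simp [eq_zero_of_mem_frontier hΩ hs hy]
    simp only [this]
    exact tendsto_const_nhds
  have hE : robinEnergy p Ω σ (fun x => ∇ u x) 0 = ∫⁻ x in Ω, ‖fderiv ℝ u x‖ₑ ^ p := by
    simp [robinEnergy, enorm_gradient, ENNReal.zero_rpow_of_pos (zero_lt_one.trans hp)]
  rw [← hE]
  exact iInf_le_of_le u <| iInf_le_of_le (fun x => ∇ u x) <| iInf_le_of_le 0 <|
    iInf_le_of_le hZ <| iInf_le_of_le htr <| iInf_le_of_le h0 <| iInf_le _ htop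

/-- On the compact support `δ` has a positive minimum, and adding `α` only lowers the weight; the
integrand is thus bounded on a set of finite measure. -/
theorem weightedNormPow_ne_top (hp : 1 < p) (hΩ : IsOpen Ω) (hb : Bornology.IsBounded Ω)
    (hne : (frontier Ω).Nonempty) (hu : Continuous u) (hc : HasCompactSupport u)
    (hs : tsupport u ⊆ Ω) : weightedNormPow p Ω σ u ≠ ∞ := by
  have hp0 : 0 < p := zero_lt_one.trans hp
  rcases (tsupport u).eq_empty_or_nonempty with hemp | hsn
  · rw [tsupport_eq_empty_iff] at hemp
    simp [weightedNormPow, hemp, ENNReal.zero_rpow_of_pos hp0]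
  obtain ⟨x₀, hx₀, hmin⟩ := IsCompact.exists_isMinOn (f := bdryDist Ω) hc hsn
    (Metric.continuous_infDist_pt _).continuousOn
  obtain ⟨M, hM⟩ := hu.bounded_above_of_compact_support hc
  have hpos : 0 < bdryDist Ω x₀ := by
    refine (isClosed_frontier.notMem_iff_infDist_pos hne).1 fun h => ?_
    rw [hΩ.frontier_eq] at h
    exact h.2 (hs hx₀)
  have hbound : weightedNormPow p Ω σ u ≤
      ∫⁻ _ in Ω, ENNReal.ofReal M ^ p / ENNReal.ofReal (bdryDist Ω x₀) ^ p := by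
    refine (lintegral_mono_set sdiff_subset).trans (lintegral_mono fun x => ?_)
    by_cases hx : x ∈ tsupport u
    · refine ENNReal.div_le_div (ENNReal.rpow_le_rpow ?_ hp0.le) (ENNReal.rpow_le_rpow ?_ hp0.le)
      · rw [← ofReal_norm]; exact ENNReal.ofReal_le_ofReal (hM x)
      · exact le_add_right (ENNReal.ofReal_le_ofReal (hmin hx))
    · rw [image_eq_zero_of_notMem_tsupport hx, enorm_zero, ENNReal.zero_rpow_of_pos hp0,
        ENNReal.zero_div]
      exact zero_le
  refine ne_top_of_le_ne_top ?_ hbound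
  rw [setLIntegral_const]
  refine ENNReal.mul_ne_top (ENNReal.div_ne_top ?_ ?_) hb.measure_lt_top.ne
  · exact ENNReal.rpow_ne_top_of_nonneg hp0.le ENNReal.ofReal_ne_top
  · exact (ENNReal.rpow_pos (ENNReal.ofReal_pos.2 hpos) ENNReal.ofReal_ne_top).ne'

end TestFunctions

/-! ### Fubini along a line and its orthogonal hyperplane -/

section Slicing

variable {E : Type*} [NormedAddCommGroup E] [InnerProductSpace ℝ E] [FiniteDimensional ℝ E]
  [MeasurableSpace E] [BorelSpace E]

/-- Fubini's theorem for the splitting of a Euclidean space into a line and its orthogonal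
hyperplane, up to a normalising factor. -/
theorem exists_lintegral_hyperproj_mul_inner {e : E} (he : ‖e‖ = 1) :
    ∃ κ : ℝ≥0, κ ≠ 0 ∧ ∀ (φ : hyperplane e → ℝ≥0∞) (ψ : ℝ → ℝ≥0∞), Measurable φ → Measurable ψ →
      ∫⁻ ζ : E, φ (hyperproj e ζ) * ψ ⟪e, ζ⟫ = κ * ((∫⁻ z, φ z) * ∫⁻ t, ψ t) := by
  let L₀ : E ≃ₗ[ℝ] hyperplane e × ℝ :=
    { toFun := fun ζ => (hyperproj e ζ, ⟪e, ζ⟫)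
      map_add' := fun x y => by simp [inner_add_right]
      map_smul' := fun c x => by simp [inner_smul_right]
      invFun := fun w => (w.1 : E) + w.2 • e
      left_inv := fun ζ => hyperproj_add_inner_smul he ζ
      right_inv := fun w => Prod.ext (hyperproj_coe_add_smul _ _) (inner_coe_add_smul he _ _) }
  let L : E ≃L[ℝ] hyperplane e × ℝ := L₀.toContinuousLinearEquiv
  -- By uniqueness of Haar measure the image of Lebesgue measure is a multiple of the product
  -- measure. The value of the factor is irrelevant, as it cancels in the Hardy quotient.
  have hL := L.isAddHaarMeasure_map (volume : Measure E)
  have h := Measure.isAddLeftInvariant_eq_smul (Measure.map L (volume : Measure E))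
    ((volume : Measure (hyperplane e)).prod (volume : Measure ℝ))
  refine ⟨_, (Measure.addHaarScalarFactor_pos_of_isAddHaarMeasure
    (Measure.map L (volume : Measure E))
    ((volume : Measure (hyperplane e)).prod (volume : Measure ℝ))).ne', ?_⟩
  intro φ ψ hφ hψ
  have h1 : ∫⁻ ζ : E, φ (hyperproj e ζ) * ψ ⟪e, ζ⟫ =
      ∫⁻ w, φ w.1 * ψ w.2 ∂(Measure.map L (volume : Measure E)) := by
    rw [lintegral_map (by fun_prop) L.continuous.measurable]
    rfl
  rw [h1]
  conv_lhs => rw [h]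
  rw [lintegral_smul_measure,
    lintegral_prod_mul hφ.aemeasurable hψ.aemeasurable]
  rfl

end Slicing

/-! ### Null sets for Hausdorff measure -/

section NullSets

theorem euclideanHausdorffMeasure_eq_zero_iff {X : Type*} [EMetricSpace X] [MeasurableSpace X]
    [BorelSpace X] {d : ℕ} {s : Set X} : μHE[d] s = 0 ↔ μH[d] s = 0 := by
  rw [Measure.euclideanHausdorffMeasure_def, Measure.smul_apply, ENNReal.smul_def, smul_eq_mul,
    mul_eq_zero]
  simp [Measure.addHaarScalarFactor_volume_hausdorffMeasure_ne_zero]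

theorem _root_.LipschitzOnWith.euclideanHausdorffMeasure_image_eq_zero {X Y : Type*} [EMetricSpace X]
    [MeasurableSpace X] [BorelSpace X] [EMetricSpace Y] [MeasurableSpace Y] [BorelSpace Y]
    {d : ℕ} {C : ℝ≥0} {f : X → Y} {s : Set X} (hf : LipschitzOnWith C f s) (hs : μHE[d] s = 0) :
    μHE[d] (f '' s) = 0 := by
  rw [euclideanHausdorffMeasure_eq_zero_iff] at hs ⊢
  have := hf.hausdorffMeasure_image_le (d := d) (by positivity)
  rw [hs, mul_zero] at this
  exact nonpos_iff_eq_zero.1 this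

theorem euclideanHausdorffMeasure_hyperplane {n : ℕ} {e : EuclideanSpace ℝ (Fin n)}
    (he : ‖e‖ = 1) : (μHE[n - 1] : Measure (hyperplane e)) = volume := by
  have h1 : Module.finrank ℝ (Submodule.span ℝ {e}) = 1 :=
    finrank_span_singleton (norm_ne_zero_iff.1 (by rw [he]; exact one_ne_zero))
  have h2 := Submodule.finrank_add_finrank_orthogonal (Submodule.span ℝ {e})
  rw [h1, finrank_euclideanSpace_fin] at h2
  have h3 : Module.finrank ℝ (hyperplane e) = n - 1 := by
    change Module.finrank ℝ (Submodule.span ℝ {e})ᗮ = n - 1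
    -- The unit vector forces `n ≥ 1`, by `h2`, so the truncated difference `n - 1` is the true one.
    omega
  rw [← h3, InnerProductSpace.euclideanHausdorffMeasure_eq_volume]

end NullSets

/-! ### The set where `σ` is infinite, read in a chart -/

section InfiniteSet

variable {n : ℕ} {Ω Γ : Set (EuclideanSpace ℝ (Fin n))} {y₀ : EuclideanSpace ℝ (Fin n)}
  {σ : EuclideanSpace ℝ (Fin n) → ℝ≥0∞}

/-- If `Γ` has positive surface measure near `y₀`, then, in the coordinates of a chart at `y₀`,
`σ = ∞` on a set of positive measure. -/
theorem NormalChart.exists_measurableSet_sigma_eq_top (c : NormalChart Ω y₀)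
    (hσ : IsRobinCoefficient Ω Γ σ)
    (hpos : ∀ t ∈ 𝓝[Γ] y₀, 0 < surfaceMeasure Ω t) {ρ : ℝ} (hρ : 0 < ρ) :
    ∃ A : Set (hyperplane c.e), MeasurableSet A ∧
      A ⊆ Metric.ball (hyperproj c.e y₀) ρ ∩ Metric.ball (hyperproj c.e y₀) c.radius ∧
      volume A ≠ 0 ∧ ∀ z ∈ A, σ (c.g z) = ∞ := by
  set z₀ := hyperproj c.e y₀ with hz₀
  set B := Metric.ball z₀ ρ ∩ Metric.ball z₀ c.radius with hB
  have hBn : B ∈ 𝓝 z₀ :=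
    Filter.inter_mem (Metric.ball_mem_nhds _ hρ) (Metric.ball_mem_nhds _ c.radius_pos)
  obtain ⟨σ', hσ'm, hσσ'⟩ := hσ.aemeasurable
  set N := {y | σ y ≠ σ' y} ∩ frontier Ω with hN
  have hNnull : μHE[n - 1] N = 0 := by
    have : surfaceMeasure Ω {y | σ y ≠ σ' y} = 0 := hσσ'
    rwa [surfaceMeasure, Measure.restrict_apply' isClosed_frontier.measurableSet] at this
  -- As `σ` is only almost everywhere measurable, it is replaced by `σ'`. The exceptional set `N`
  -- projects to a null set, which is removed inside a measurable null set `Z`; this leaves a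
  -- measurable set even if `Γ` is not measurable.
  have hPN : volume (hyperproj c.e '' N) = 0 := by
    rw [← euclideanHausdorffMeasure_hyperplane c.norm_e]
    exact ((Submodule.lipschitzWith_orthogonalProjectionOnto
      (hyperplane c.e)).lipschitzOnWith).euclideanHausdorffMeasure_image_eq_zero hNnull
  obtain ⟨Z, hNZ, hZm, hZ⟩ := exists_measurable_superset_of_null hPN
  have hg : Measurable c.g := c.contDiff_g.continuous.measurable
  refine ⟨(B ∩ (fun z => σ' (c.g z)) ⁻¹' {∞}) \ Z,
    ((Metric.isOpen_ball.inter Metric.isOpen_ball).measurableSet.inter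
      ((hσ'm.comp hg) (measurableSet_singleton _))).diff hZm,
    fun z hz => hz.1.1, fun h0 => ?_, ?_⟩
  · obtain ⟨C, t, ht, hLip⟩ := c.contDiff_g.contDiffAt.exists_lipschitzOnWith (x := z₀)
    -- If the set constructed were null, so would be its union with `Z` and the image of that under
    -- the locally Lipschitz `g`. Up to `N`, this image covers `Γ` near `y₀`, against `hpos`.
    set D := t ∩ (((B ∩ (fun z => σ' (c.g z)) ⁻¹' {∞}) \ Z) ∪ Z) with hD
    have hDnull : μHE[n - 1] (c.g '' D) = 0 := by
      refine (hLip.mono inter_subset_left).euclideanHausdorffMeasure_image_eq_zero ?_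
      rw [euclideanHausdorffMeasure_hyperplane c.norm_e]
      exact measure_mono_null inter_subset_right (measure_union_null h0 hZ)
    have hV : (hyperproj c.e) ⁻¹' (t ∩ B) ∩ {y | y ∈ frontier Ω → c.g (hyperproj c.e y) = y}
        ∈ 𝓝 y₀ :=
      Filter.inter_mem ((hyperproj c.e).continuous.continuousAt.preimage_mem_nhds
        (Filter.inter_mem ht hBn)) c.eventually_eq_g
    refine (hpos _ (inter_mem_nhdsWithin Γ hV)).ne' ?_
    rw [surfaceMeasure, Measure.restrict_apply' isClosed_frontier.measurableSet]
    refine measure_mono_null ?_ (measure_union_null hNnull hDnull)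
    rintro y ⟨⟨hyΓ, ⟨hyt, hyB⟩, hyg⟩, hyf⟩
    by_cases hyN : y ∈ N
    · exact Or.inl hyN
    right
    have hgy := hyg hyf
    refine ⟨hyperproj c.e y, ⟨hyt, ?_⟩, hgy⟩
    by_cases hyZ : hyperproj c.e y ∈ Z
    · exact Or.inr hyZ
    refine Or.inl ⟨⟨hyB, ?_⟩, hyZ⟩
    have h1 : σ y = σ' y := by
      by_contra h
      exact hyN ⟨h, hyf⟩
    rw [mem_preimage, hgy, mem_singleton_iff, ← h1]
    exact hσ.eq_top y hyΓ
  · rintro z ⟨⟨hzB, hz⟩, hzZ⟩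
    have hzf : c.g z ∈ frontier Ω := c.g_mem_frontier z hzB.2
    have : σ (c.g z) = σ' (c.g z) := by
      by_contra h
      exact hzZ (hNZ ⟨c.g z, ⟨h, hzf⟩, c.hyperproj_g z⟩)
    rw [this]
    exact hz

end InfiniteSet

/-! ### Tangential cutoffs -/

section Cutoff

variable {F : Type*} [NormedAddCommGroup F] [InnerProductSpace ℝ F] [FiniteDimensional ℝ F]
  [MeasurableSpace F] [BorelSpace F]

/-- A smooth cutoff function which is concentrated on a given set of positive measure. -/
theorem exists_contDiff_cutoff {A O : Set F} (hA : MeasurableSet A) (hO : IsOpen O) (hAO : A ⊆ O)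
    (h0 : volume A ≠ 0) (htop : volume A ≠ ∞) {η : ℝ≥0} (hη : η ≠ 0) :
    ∃ (K U : Set F) (χ : F → ℝ), MeasurableSet K ∧ K ⊆ A ∧ volume K ≠ 0 ∧
      IsOpen U ∧ U ⊆ O ∧ K ⊆ U ∧ volume (U \ K) ≤ η * volume K ∧
      ContDiff ℝ 1 χ ∧ HasCompactSupport χ ∧ tsupport χ ⊆ U ∧ (∀ z, χ z ∈ Icc 0 1) ∧
      ∀ z ∈ K, χ z = 1 := by
  obtain ⟨K, hKA, hK, hlt⟩ := hA.exists_lt_isCompact_of_ne_top htop (pos_iff_ne_zero.2 h0)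
  have hKtop : volume K ≠ ∞ := hK.measure_lt_top.ne
  -- The allowed excess is `η * volume K`, relative to `K` and not to `A`, because only `K` will
  -- contribute to the denominator.
  obtain ⟨U₁, hKU₁, hU₁, hU₁lt⟩ := K.exists_isOpen_lt_add hKtop
    (mul_ne_zero (ENNReal.coe_ne_zero.2 hη) hlt.ne')
  have hKU : K ⊆ U₁ ∩ O := subset_inter hKU₁ (hKA.trans hAO)
  obtain ⟨K', hK', hKK', hK'U⟩ := exists_compact_between hK (hU₁.inter hO) hKU
  obtain ⟨f, hf1, hf0, hf⟩ := exists_contMDiffMap_one_nhds_of_subset_interior (n := 1)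
    (modelWithCornersSelf ℝ F) hK.isClosed hKK'
  have hts : tsupport f ⊆ K' := by
    refine closure_minimal (fun x hx => ?_) hK'.isClosed
    by_contra h
    exact hx (hf0 x h)
  refine ⟨K, U₁ ∩ O, f, hK.measurableSet, hKA, hlt.ne', hU₁.inter hO, inter_subset_right,
    hKU, ?_, f.contMDiff.contDiff, hK'.of_isClosed_subset (isClosed_tsupport _) hts,
    hts.trans hK'U, hf, fun z hz => (hf1.self_of_nhdsSet z hz)⟩
  refine (measure_mono (sdiff_subset_sdiff_left inter_subset_left)).trans ?_
  rw [measure_sdiff hKU₁ hK.measurableSet.nullMeasurableSet hKtop]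
  exact tsub_le_iff_left.2 hU₁lt.le

end Cutoff

/-! ### The radial profile in the logarithmic variable -/

section Profile

/-- The logarithmic variable `log t / L + 4`, which ranges over `[-2, 2]` for
`t ∈ [exp (-6L), exp (-2L)]`. -/
noncomputable def logVar (L t : ℝ) : ℝ := Real.log t / L + 4

/-- A function of class `C¹` with compact support in `(0, ∞)`, close to `t ^ a` on a large
logarithmic scale. -/
noncomputable def hardyProfile (a : ℝ) (h : ℝ → ℝ) (L t : ℝ) : ℝ :=
  if 0 < t then t ^ a * h (logVar L t) else 0

theorem measurable_logVar (L : ℝ) : Measurable (logVar L) :=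
  (Real.measurable_log.div_const L).add_const 4

variable {a L t : ℝ} {h : ℝ → ℝ}

theorem mem_Icc_of_logVar_mem (hL : 0 < L) (ht : 0 < t) (hs : logVar L t ∈ Icc (-2) 2) :
    t ∈ Icc (Real.exp (-6 * L)) (Real.exp (-2 * L)) := by
  obtain ⟨h1, h2⟩ := hs
  rw [logVar] at h1 h2
  have h3 : -6 * L ≤ Real.log t := by
    rw [← le_div_iff₀ hL]; linarith
  have h4 : Real.log t ≤ -2 * L := by
    rw [← div_le_iff₀ hL]; linarith
  exact ⟨(Real.le_log_iff_exp_le ht).1 h3, (Real.log_le_iff_le_exp ht).1 h4⟩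

theorem hardyProfile_eq_zero (hL : 0 < L) (hh : ∀ s, s ∉ Icc (-2) 2 → h s = 0)
    (ht : t ∉ Icc (Real.exp (-6 * L)) (Real.exp (-2 * L))) : hardyProfile a h L t = 0 := by
  rw [hardyProfile]
  split_ifs with h0
  · rw [hh _ fun hs => ht (mem_Icc_of_logVar_mem hL h0 hs), mul_zero]
  · rfl

/-- The logarithmic cutoff changes the derivative of `t ^ a` only by a term of relative order `1 /
L`, uniformly in `t`. -/
theorem hasDerivAt_hardyProfile (hh : Differentiable ℝ h) (ht : 0 < t) :
    HasDerivAt (hardyProfile a h L)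
      (t ^ (a - 1) * (a * h (logVar L t) + deriv h (logVar L t) / L)) t := by
  have h1 : HasDerivAt (logVar L) (t⁻¹ / L) t :=
    ((Real.hasDerivAt_log ht.ne').div_const L).add_const 4
  have h2 := (Real.hasDerivAt_rpow_const (p := a) (Or.inl ht.ne')).mul
    ((hh (logVar L t)).hasDerivAt.comp t h1)
  have h3 : t ^ a = t ^ (a - 1) * t := by
    rw [Real.rpow_sub_one ht.ne']; field_simp
  refine (h2.congr_of_eventuallyEq ?_).congr_deriv ?_
  · filter_upwards [lt_mem_nhds ht] with s hs
    simp [hardyProfile, hs]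
  · rw [h3]
    simp only [Function.comp_apply]
    field_simp

theorem contDiff_hardyProfile (hL : 0 < L) (hh : ContDiff ℝ 1 h)
    (h0 : ∀ s, s ∉ Icc (-2) 2 → h s = 0) : ContDiff ℝ 1 (hardyProfile a h L) := by
  rw [contDiff_iff_contDiffAt]
  intro t
  by_cases ht : 0 < t
  · have h1 : ContDiffAt ℝ 1 (fun t => t ^ a * h (logVar L t)) t := by
      refine (Real.contDiffAt_rpow_const_of_ne ht.ne').mul (hh.contDiffAt.comp t ?_)
      exact ((Real.contDiffAt_log.2 ht.ne').div_const L).add contDiffAt_const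
    refine h1.congr_of_eventuallyEq ?_
    filter_upwards [lt_mem_nhds ht] with s hs
    simp [hardyProfile, hs]
  · have h2 : t < Real.exp (-6 * L) := (not_lt.1 ht).trans_lt (Real.exp_pos _)
    refine (contDiffAt_const (c := (0 : ℝ))).congr_of_eventuallyEq ?_
    filter_upwards [gt_mem_nhds h2] with s hs
    exact hardyProfile_eq_zero hL h0 fun hs' => hs.not_ge hs'.1

/-- Substitution `t = exp (L (s - 4))`, under which `dt / t = L ds`. -/
theorem lintegral_inv_mul_logVar (hL : 0 < L) (G : ℝ → ℝ≥0∞) :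
    ∫⁻ t, ENNReal.ofReal t⁻¹ * G (logVar L t) = ENNReal.ofReal L * ∫⁻ s, G s := by
  have hpos : ∫⁻ t, ENNReal.ofReal t⁻¹ * G (logVar L t) =
      ∫⁻ t in Ioi 0, ENNReal.ofReal t⁻¹ * G (logVar L t) := by
    rw [setLIntegral_eq_of_support_subset]
    intro t ht
    by_contra hn
    refine ht ?_
    have : t⁻¹ ≤ 0 := inv_nonpos.2 (not_lt.1 hn)
    simp [ENNReal.ofReal_of_nonpos this]
  have himg : (fun s : ℝ => Real.exp (L * (s - 4))) '' univ = Ioi 0 := by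
    ext t
    simp only [image_univ, mem_range, mem_Ioi]
    constructor
    · rintro ⟨s, rfl⟩; exact Real.exp_pos _
    · intro ht
      exact ⟨Real.log t / L + 4, by
        rw [add_sub_cancel_right, mul_div_cancel₀ _ hL.ne', Real.exp_log ht]⟩
  have hder : ∀ s ∈ (univ : Set ℝ), HasDerivWithinAt (fun s : ℝ => Real.exp (L * (s - 4)))
      (Real.exp (L * (s - 4)) * L) univ s := fun s _ => by
    have h1 : HasDerivAt (fun s : ℝ => L * (s - 4)) L s := by
      simpa using ((hasDerivAt_id s).sub_const 4).const_mul L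
    exact h1.exp.hasDerivWithinAt
  have hinj : InjOn (fun s : ℝ => Real.exp (L * (s - 4))) univ := fun s _ t _ hst => by
    have := mul_left_cancel₀ hL.ne' (Real.exp_injective hst)
    linarith
  rw [hpos, ← himg, lintegral_image_eq_lintegral_abs_deriv_mul MeasurableSet.univ hder hinj,
    setLIntegral_univ, ← lintegral_const_mul' _ _ ENNReal.ofReal_ne_top]
  refine lintegral_congr fun s => ?_
  have h1 : logVar L (Real.exp (L * (s - 4))) = s := by
    rw [logVar, Real.log_exp]; field_simp; ring
  rw [h1, ← mul_assoc, ← ENNReal.ofReal_mul (abs_nonneg _), abs_of_pos (by positivity)]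
  congr 2
  field_simp

end Profile

/-! ### Transporting functions through a chart -/

section Transport

variable {n : ℕ} {Ω : Set (EuclideanSpace ℝ (Fin n))} {y₀ : EuclideanSpace ℝ (Fin n)}

/-- The function on the domain of a chart given by `w` in the coordinates of the chart, extended by
zero. -/
noncomputable def NormalChart.push (c : NormalChart Ω y₀) (w : EuclideanSpace ℝ (Fin n) → ℝ) :
    EuclideanSpace ℝ (Fin n) → ℝ :=
  c.Φ.target.indicator fun x => w (c.Φ.symm x)

variable (c : NormalChart Ω y₀) {w : EuclideanSpace ℝ (Fin n) → ℝ}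
  {Q : Set (EuclideanSpace ℝ (Fin n))}

theorem NormalChart.push_apply {ζ : EuclideanSpace ℝ (Fin n)} (hζ : ζ ∈ c.Φ.source) :
    c.push w (c.Φ ζ) = w ζ := by
  rw [push, indicator_of_mem (c.Φ.map_source hζ), c.Φ.left_inv hζ]

theorem NormalChart.isCompact_image (hQ : IsCompact Q) : IsCompact (c.Φ '' Q) :=
  hQ.image c.contDiff.continuous

theorem NormalChart.tsupport_push_subset (hQ : IsCompact Q)
    (hw : ∀ ζ, ζ ∉ Q → w ζ = 0) : tsupport (c.push w) ⊆ c.Φ '' Q := by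
  refine closure_minimal (fun x hx => ?_) (c.isCompact_image hQ).isClosed
  by_cases hxt : x ∈ c.Φ.target
  · refine ⟨c.Φ.symm x, ?_, c.Φ.right_inv hxt⟩
    by_contra h
    apply hx
    rw [push, indicator_of_mem hxt, hw _ h]
  · exact absurd (indicator_of_notMem hxt _) hx

theorem NormalChart.hasCompactSupport_push (hQ : IsCompact Q)
    (hw : ∀ ζ, ζ ∉ Q → w ζ = 0) : HasCompactSupport (c.push w) :=
  (c.isCompact_image hQ).of_isClosed_subset (isClosed_tsupport _) (c.tsupport_push_subset hQ hw)

theorem NormalChart.contDiff_push (hQ : IsCompact Q) (hQs : Q ⊆ c.Φ.source)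
    (hw : ∀ ζ, ζ ∉ Q → w ζ = 0) (hwc : ContDiff ℝ 1 w) : ContDiff ℝ 1 (c.push w) := by
  rw [contDiff_iff_contDiffAt]
  intro x
  by_cases hxt : x ∈ c.Φ.target
  · refine (hwc.contDiffAt.comp x (c.contDiffAt_symm x hxt)).congr_of_eventuallyEq ?_
    filter_upwards [c.Φ.open_target.mem_nhds hxt] with y hy
    rw [push, indicator_of_mem hy, Function.comp_apply]
  · have hx : x ∉ c.Φ '' Q := by
      rintro ⟨ζ, hζ, rfl⟩
      exact hxt (c.Φ.map_source (hQs hζ))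
    refine (contDiffAt_const (c := (0 : ℝ))).congr_of_eventuallyEq ?_
    filter_upwards [(c.isCompact_image hQ).isClosed.isOpen_compl.mem_nhds hx] with y hy
    by_contra h
    exact hy (c.tsupport_push_subset hQ hw (subset_tsupport _ h))

/-- The gradient of a function of the form `f(δ(x)) χ(π(x))`. -/
theorem NormalChart.norm_fderiv_push_le {f : ℝ → ℝ} {χ : hyperplane c.e → ℝ} {f' : ℝ}
    {ζ : EuclideanSpace ℝ (Fin n)} (hζ : ζ ∈ c.Φ.source) (hpos : 0 < ⟪c.e, ζ⟫)
    (hf : HasDerivAt f f' ⟪c.e, ζ⟫) (hχ : ContDiff ℝ 1 χ) :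
    ‖fderiv ℝ (c.push fun ζ => f ⟪c.e, ζ⟫ * χ (hyperproj c.e ζ)) (c.Φ ζ)‖ ≤
      |f'| * |χ (hyperproj c.e ζ)| +
        |f ⟪c.e, ζ⟫| * (‖fderiv ℝ χ (hyperproj c.e ζ)‖ * c.symmBound) := by
  set x := c.Φ ζ with hx
  have hxt : x ∈ c.Φ.target := c.Φ.map_source hζ
  have hsx : c.Φ.symm x = ζ := c.Φ.left_inv hζ
  have hS : HasFDerivAt c.Φ.symm (fderiv ℝ c.Φ.symm x) x :=
    ((c.contDiffAt_symm x hxt).differentiableAt (by norm_num)).hasFDerivAt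
  set D₁ := (innerSL ℝ c.e).comp (fderiv ℝ c.Φ.symm x) with hD₁
  have h1 : HasFDerivAt (fun y => ⟪c.e, c.Φ.symm y⟫) D₁ x :=
    (innerSL ℝ c.e).hasFDerivAt.comp x hS
  -- The normal coordinate is `δ`, which is 1-Lipschitz. Bounding `D₁` by `symmBound` instead would
  -- lose the sharp constant.
  have hD₁le : ‖D₁‖ ≤ 1 := by
    have hev : (fun y => ⟪c.e, c.Φ.symm y⟫) =ᶠ[𝓝 x] bdryDist Ω := by
      have hc : ∀ᶠ y in 𝓝 x, 0 < ⟪c.e, c.Φ.symm y⟫ := by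
        refine h1.continuousAt.eventually_const_lt ?_
        simpa only [hsx] using hpos
      filter_upwards [hc, c.Φ.open_target.mem_nhds hxt] with y hy hyt
      rw [← c.bdryDist_eq _ (c.Φ.map_target hyt) hy, c.Φ.right_inv hyt]
    have := (h1.congr_of_eventuallyEq hev.symm).le_of_lipschitz
      (Metric.lipschitz_infDist_pt (frontier Ω))
    simpa using this
  have h2 : HasFDerivAt (fun y => f ⟪c.e, c.Φ.symm y⟫) (f' • D₁) x := by
    rw [← hsx] at hf
    exact hf.comp_hasFDerivAt x h1
  set D₂ := ((fderiv ℝ χ (hyperproj c.e ζ)).comp (hyperproj c.e)).comp (fderiv ℝ c.Φ.symm x)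
    with hD₂
  have h3 : HasFDerivAt (fun y => χ (hyperproj c.e (c.Φ.symm y))) D₂ x := by
    have hχ' : HasFDerivAt χ (fderiv ℝ χ (hyperproj c.e ζ)) (hyperproj c.e (c.Φ.symm x)) := by
      rw [hsx]; exact (hχ.differentiable (by norm_num) _).hasFDerivAt
    exact (hχ'.comp (c.Φ.symm x) (hyperproj c.e).hasFDerivAt).comp x hS
  have hD₂le : ‖D₂‖ ≤ ‖fderiv ℝ χ (hyperproj c.e ζ)‖ * c.symmBound := by
    refine (ContinuousLinearMap.opNorm_comp_le _ _).trans ?_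
    refine mul_le_mul ?_ (c.norm_fderiv_symm_le x hxt) (norm_nonneg _)
      (norm_nonneg (fderiv ℝ χ (hyperproj c.e ζ)))
    refine (ContinuousLinearMap.opNorm_comp_le _ _).trans ?_
    exact mul_le_of_le_one_right (norm_nonneg _) (Submodule.orthogonalProjectionOnto_norm_le _)
  have h4 := h2.mul h3
  rw [hsx] at h4
  have h5 : HasFDerivAt (c.push fun ζ => f ⟪c.e, ζ⟫ * χ (hyperproj c.e ζ))
      (f ⟪c.e, ζ⟫ • D₂ + χ (hyperproj c.e ζ) • f' • D₁) x := by
    refine h4.congr_of_eventuallyEq ?_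
    filter_upwards [c.Φ.open_target.mem_nhds hxt] with y hy
    rw [push, indicator_of_mem hy]
    rfl
  rw [h5.fderiv, add_comm]
  refine (norm_add_le _ _).trans (add_le_add ?_ ?_)
  · rw [norm_smul, norm_smul, Real.norm_eq_abs, Real.norm_eq_abs, mul_comm |f'|]
    nlinarith [mul_nonneg (abs_nonneg (χ (hyperproj c.e ζ))) (abs_nonneg f')]
  · rw [norm_smul, Real.norm_eq_abs]
    exact mul_le_mul_of_nonneg_left hD₂le (abs_nonneg _)

end Transport

/-! ### Lebesgue measure in chart coordinates -/

section ChartMeasure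

variable {n : ℕ} {Ω : Set (EuclideanSpace ℝ (Fin n))} {y₀ : EuclideanSpace ℝ (Fin n)}
  (c : NormalChart Ω y₀)

/-- The part of the coordinate domain of a chart that corresponds to points of `Ω`. -/
def NormalChart.inner : Set (EuclideanSpace ℝ (Fin n)) := c.Φ.source ∩ {ζ | 0 < ⟪c.e, ζ⟫}

/-- Lebesgue measure on `Ω`, read in the coordinates of a chart. -/
noncomputable def NormalChart.measure : Measure (EuclideanSpace ℝ (Fin n)) :=
  (volume.restrict c.inner).withDensity fun ζ => ENNReal.ofReal |(fderiv ℝ c.Φ ζ).det|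

theorem NormalChart.measurableSet_inner : MeasurableSet c.inner :=
  (c.Φ.open_source.inter
    (isOpen_lt continuous_const (continuous_const.inner continuous_id))).measurableSet

theorem NormalChart.measurable_density :
    Measurable fun ζ => ENNReal.ofReal |(fderiv ℝ c.Φ ζ).det| :=
  (ENNReal.continuous_ofReal.comp (ContinuousLinearMap.continuous_det.comp
    (c.contDiff.continuous_fderiv (by norm_num))).abs).measurable

theorem NormalChart.lintegral_image_inner (k : EuclideanSpace ℝ (Fin n) → ℝ≥0∞) :
    ∫⁻ x in c.Φ '' c.inner, k x =
      ∫⁻ ζ in c.inner, ENNReal.ofReal |(fderiv ℝ c.Φ ζ).det| * k (c.Φ ζ) :=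
  lintegral_image_eq_lintegral_abs_det_fderiv_mul volume c.measurableSet_inner
    (fun ζ _ => (c.contDiff.differentiable (by norm_num) ζ).hasFDerivAt.hasFDerivWithinAt)
    (c.Φ.injOn.mono inter_subset_left) k

theorem NormalChart.lintegral_measure {k : EuclideanSpace ℝ (Fin n) → ℝ≥0∞} (hk : Measurable k) :
    ∫⁻ ζ, k ζ ∂c.measure =
      ∫⁻ ζ in c.inner, ENNReal.ofReal |(fderiv ℝ c.Φ ζ).det| * k ζ := by
  rw [measure, lintegral_withDensity_eq_lintegral_mul _ c.measurable_density hk]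
  rfl

/-- Measurability is asked of the comparison function only, so no measurability of the original
integrand has to be checked, here or in the converse bound; the weight with `nearestPoint` and `σ`
is such an integrand. -/
theorem NormalChart.lintegral_image_inner_le {k k' : EuclideanSpace ℝ (Fin n) → ℝ≥0∞}
    (hk' : Measurable k') (h : ∀ ζ ∈ c.inner, k (c.Φ ζ) ≤ k' ζ) :
    ∫⁻ x in c.Φ '' c.inner, k x ≤ ∫⁻ ζ, k' ζ ∂c.measure := by
  rw [c.lintegral_image_inner, c.lintegral_measure hk']
  exact setLIntegral_mono' c.measurableSet_inner fun ζ hζ => mul_le_mul_right (h ζ hζ) _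

theorem NormalChart.le_lintegral_image_inner {k k' : EuclideanSpace ℝ (Fin n) → ℝ≥0∞}
    (hk' : Measurable k') (h : ∀ ζ ∈ c.inner, k' ζ ≤ k (c.Φ ζ)) :
    ∫⁻ ζ, k' ζ ∂c.measure ≤ ∫⁻ x in c.Φ '' c.inner, k x := by
  rw [c.lintegral_image_inner, c.lintegral_measure hk']
  exact setLIntegral_mono' c.measurableSet_inner fun ζ hζ => mul_le_mul_right (h ζ hζ) _

theorem NormalChart.lintegral_measure_le {k : EuclideanSpace ℝ (Fin n) → ℝ≥0∞}
    (hk : Measurable k) : ∫⁻ ζ, k ζ ∂c.measure ≤ c.detUpper * ∫⁻ ζ, k ζ := by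
  rw [c.lintegral_measure hk, ← lintegral_const_mul _ hk]
  refine (setLIntegral_mono' c.measurableSet_inner fun ζ hζ => ?_).trans
    (setLIntegral_le_lintegral _ _)
  refine mul_le_mul_left ?_ _
  rw [← ENNReal.ofReal_coe_nnreal]
  exact ENNReal.ofReal_le_ofReal (c.le_detUpper ζ hζ.1)

theorem NormalChart.le_lintegral_measure {k : EuclideanSpace ℝ (Fin n) → ℝ≥0∞}
    (hk : Measurable k) (hs : Function.support k ⊆ c.inner) :
    c.detLower * ∫⁻ ζ, k ζ ≤ ∫⁻ ζ, k ζ ∂c.measure := by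
  rw [c.lintegral_measure hk, ← lintegral_const_mul _ hk,
    ← setLIntegral_eq_of_support_subset (s := c.inner)
      ((Function.support_mul_subset_right _ _).trans hs)]
  refine setLIntegral_mono' c.measurableSet_inner fun ζ hζ => mul_le_mul_left ?_ _
  rw [← ENNReal.ofReal_coe_nnreal]
  exact ENNReal.ofReal_le_ofReal (c.detLower_le ζ hζ.1)

theorem NormalChart.image_inner_subset : c.Φ '' c.inner ⊆ Ω \ singularSet Ω := by
  rintro _ ⟨ζ, hζ, rfl⟩
  exact ⟨(c.mem_iff ζ hζ.1).2 hζ.2, c.notMem_singularSet ζ hζ.1⟩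

theorem NormalChart.mem_source_of_lt {ζ : EuclideanSpace ℝ (Fin n)}
    (h1 : hyperproj c.e ζ ∈ Metric.ball (hyperproj c.e y₀) (c.radius / 2))
    (h2 : |⟪c.e, ζ⟫| < c.radius / 2) : ζ ∈ c.Φ.source := by
  rw [c.source_eq, Metric.mem_ball, dist_eq_norm]
  have e1 : ζ - (hyperproj c.e y₀ : EuclideanSpace ℝ (Fin n)) =
      ((hyperproj c.e ζ - hyperproj c.e y₀ : hyperplane c.e) : EuclideanSpace ℝ (Fin n)) +
        ⟪c.e, ζ⟫ • c.e := by
    nth_rw 1 [← hyperproj_add_inner_smul c.norm_e ζ]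
    rw [Submodule.coe_sub]; abel
  rw [e1]
  refine (norm_add_le _ _).trans_lt ?_
  rw [norm_smul, c.norm_e, mul_one, Real.norm_eq_abs]
  have h3 : ‖((hyperproj c.e ζ - hyperproj c.e y₀ : hyperplane c.e) :
      EuclideanSpace ℝ (Fin n))‖ < c.radius / 2 := by
    rw [Metric.mem_ball, dist_eq_norm] at h1; exact h1
  linarith

theorem NormalChart.symmBound_nonneg : 0 ≤ c.symmBound := by
  have h : (hyperproj c.e y₀ : EuclideanSpace ℝ (Fin n)) ∈ c.Φ.source := by
    rw [c.source_eq]; exact Metric.mem_ball_self c.radius_pos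
  exact (norm_nonneg _).trans (c.norm_fderiv_symm_le _ (c.Φ.map_source h))

/-- The product of the indicator function of `B`, in the tangential variable, and of a function of
the distance to the boundary. -/
noncomputable def productDensity (e : EuclideanSpace ℝ (Fin n)) (B : Set (hyperplane e))
    (L : ℝ) (G : ℝ → ℝ≥0∞) (ζ : EuclideanSpace ℝ (Fin n)) : ℝ≥0∞ :=
  B.indicator 1 (hyperproj e ζ) * (ENNReal.ofReal (⟪e, ζ⟫)⁻¹ * G (logVar L ⟪e, ζ⟫))

variable {B : Set (hyperplane c.e)} {L : ℝ} {G : ℝ → ℝ≥0∞}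

theorem measurable_inv_mul_logVar (L : ℝ) (hG : Measurable G) :
    Measurable fun t : ℝ => ENNReal.ofReal t⁻¹ * G (logVar L t) :=
  measurable_inv.ennreal_ofReal.mul (hG.comp (measurable_logVar L))

theorem measurable_productDensity {e : EuclideanSpace ℝ (Fin n)} {B : Set (hyperplane e)}
    (hB : MeasurableSet B) (hG : Measurable G) : Measurable (productDensity e B L G) :=
  ((measurable_one.indicator hB).comp (hyperproj e).continuous.measurable).mul
    ((measurable_inv_mul_logVar L hG).comp
      (continuous_const.inner continuous_id : Continuous fun ζ => ⟪e, ζ⟫).measurable)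

theorem support_productDensity_subset (hL : 0 < L)
    (hLr : Real.exp (-2 * L) < c.radius / 2)
    (hBr : B ⊆ Metric.ball (hyperproj c.e y₀) (c.radius / 2))
    (hG0 : ∀ s, s ∉ Icc (-2) 2 → G s = 0) :
    Function.support (productDensity c.e B L G) ⊆ c.inner := by
  intro ζ hζ
  rw [Function.mem_support, productDensity, mul_ne_zero_iff, mul_ne_zero_iff] at hζ
  obtain ⟨h1, h2, h3⟩ := hζ
  have hz : hyperproj c.e ζ ∈ B := by
    by_contra h
    exact h1 (indicator_of_notMem h _)
  have ht : 0 < ⟪c.e, ζ⟫ := by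
    by_contra h
    exact h2 (ENNReal.ofReal_of_nonpos (inv_nonpos.2 (not_lt.1 h)))
  have hs : logVar L ⟪c.e, ζ⟫ ∈ Icc (-2) 2 := by
    by_contra h
    exact h3 (hG0 _ h)
  refine ⟨c.mem_source_of_lt (hBr hz) ?_, ht⟩
  rw [abs_of_pos ht]
  exact (mem_Icc_of_logVar_mem hL ht hs).2.trans_lt hLr

/-- The integrals of product densities are comparable to products of integrals. -/
theorem NormalChart.exists_lintegral_productDensity_bounds : ∃ κ : ℝ≥0, κ ≠ 0 ∧
    ∀ (B : Set (hyperplane c.e)) (L : ℝ) (G : ℝ → ℝ≥0∞), MeasurableSet B → Measurable G →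
      0 < L →
      ∫⁻ ζ, productDensity c.e B L G ζ ∂c.measure ≤
        c.detUpper * (κ * (volume B * (ENNReal.ofReal L * ∫⁻ s, G s))) ∧
      (Real.exp (-2 * L) < c.radius / 2 →
        B ⊆ Metric.ball (hyperproj c.e y₀) (c.radius / 2) →
        (∀ s, s ∉ Icc (-2) 2 → G s = 0) →
        c.detLower * (κ * (volume B * (ENNReal.ofReal L * ∫⁻ s, G s))) ≤
          ∫⁻ ζ, productDensity c.e B L G ζ ∂c.measure) := by
  obtain ⟨κ, hκ, h⟩ := exists_lintegral_hyperproj_mul_inner c.norm_e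
  refine ⟨κ, hκ, fun B L G hB hG hL => ?_⟩
  have hI : ∫⁻ ζ, productDensity c.e B L G ζ =
      κ * (volume B * (ENNReal.ofReal L * ∫⁻ s, G s)) := by
    have := h (B.indicator 1) (fun t => ENNReal.ofReal t⁻¹ * G (logVar L t))
      (measurable_one.indicator hB) (measurable_inv_mul_logVar L hG)
    rw [lintegral_indicator_one hB, lintegral_inv_mul_logVar hL] at this
    exact this
  rw [← hI]
  exact ⟨c.lintegral_measure_le (measurable_productDensity hB hG), fun hLr hBr hG0 =>
    c.le_lintegral_measure (measurable_productDensity hB hG)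
      (support_productDensity_subset c hL hLr hBr hG0)⟩

end ChartMeasure

/-! ### The cutoff in the logarithmic variable -/

section LogProfile

/-- A cutoff function in the logarithmic variable. -/
structure IsLogCutoff (h : ℝ → ℝ) (M : ℝ) : Prop where
  contDiff : ContDiff ℝ 1 h
  nonneg : ∀ s, 0 ≤ h s
  le_one : ∀ s, h s ≤ 1
  eq_zero : ∀ s, s ∉ Icc (-2) 2 → h s = 0
  deriv_eq_zero : ∀ s, s ∉ Icc (-2) 2 → deriv h s = 0
  abs_deriv_le : ∀ s, |deriv h s| ≤ M
  eq_one : ∀ s ∈ Icc (-1) 1, h s = 1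

theorem exists_isLogCutoff : ∃ (h : ℝ → ℝ) (M : ℝ), IsLogCutoff h M := by
  let f : ContDiffBump (0 : ℝ) := ⟨1, 2, one_pos, one_lt_two⟩
  have hf : ContDiff ℝ 1 f := f.contDiff
  have hts : tsupport f = Icc (-2) 2 := by
    rw [f.tsupport_eq, Real.closedBall_eq_Icc]; norm_num [f]
  obtain ⟨M, hM⟩ := (hf.continuous_deriv (by norm_num)).bounded_above_of_compact_support
    f.hasCompactSupport.deriv
  refine ⟨f, M, hf, fun s => f.nonneg, fun s => f.le_one, fun s hs => ?_, fun s hs => ?_,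
    fun s => hM s, fun s hs => ?_⟩
  · exact image_eq_zero_of_notMem_tsupport (hts ▸ hs)
  · by_contra h
    exact hs (hts ▸ support_deriv_subset h)
  · refine f.one_of_mem_closedBall ?_
    rw [Real.closedBall_eq_Icc]; simpa [f] using hs

variable {h : ℝ → ℝ} {M p : ℝ}

theorem IsLogCutoff.nonneg_bound (hh : IsLogCutoff h M) : 0 ≤ M :=
  (abs_nonneg _).trans (hh.abs_deriv_le 0)

theorem IsLogCutoff.measurable_rpow (hh : IsLogCutoff h M) :
    Measurable fun s => ENNReal.ofReal (h s) ^ p :=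
  hh.contDiff.continuous.measurable.ennreal_ofReal.pow_const p

theorem IsLogCutoff.one_le_lintegral (hh : IsLogCutoff h M) :
    1 ≤ ∫⁻ s, ENNReal.ofReal (h s) ^ p := by
  have h1 : ∫⁻ s in Icc (-1 : ℝ) 1, (1 : ℝ≥0∞) ≤ ∫⁻ s, ENNReal.ofReal (h s) ^ p := by
    refine (setLIntegral_mono' measurableSet_Icc fun s hs => ?_).trans
      (setLIntegral_le_lintegral (Icc (-1 : ℝ) 1) _)
    rw [hh.eq_one s hs]; simp
  refine le_trans ?_ h1
  rw [setLIntegral_one, Real.volume_Icc, ENNReal.one_le_ofReal]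
  norm_num

end LogProfile

/-! ### Energy and weighted norm of the test function -/

section TestFunction

/-- The pointwise gradient bound is written as a sum of `p`-th roots of densities, ready for
Minkowski's inequality; this computes each root. -/
theorem ofReal_mul_rpow_mul_rpow_inv {p b t s : ℝ} (hp : 0 < p) (hb : 0 ≤ b) (ht : 0 < t)
    (hs : 0 ≤ s) :
    (ENNReal.ofReal b ^ p * (ENNReal.ofReal t⁻¹ * ENNReal.ofReal s ^ p)) ^ (1 / p) =
      ENNReal.ofReal (b * t ^ (-(1 / p)) * s) := by
  have h1 : ENNReal.ofReal b ^ p * (ENNReal.ofReal t⁻¹ * ENNReal.ofReal s ^ p) =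
      ENNReal.ofReal (b * t ^ (-(1 / p)) * s) ^ p := by
    have h2 : (t ^ (-(1 / p))) ^ p = t⁻¹ := by
      rw [← Real.rpow_mul ht.le, ← Real.rpow_neg_one]
      congr 1
      field_simp
    rw [ENNReal.ofReal_rpow_of_nonneg hb hp.le, ENNReal.ofReal_rpow_of_nonneg hs hp.le,
      ENNReal.ofReal_rpow_of_nonneg (by positivity) hp.le, ← ENNReal.ofReal_mul (by positivity),
      ← ENNReal.ofReal_mul (by positivity), Real.mul_rpow (by positivity) hs,
      Real.mul_rpow hb (by positivity), h2, mul_assoc]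
  rw [h1, ← ENNReal.rpow_mul, mul_one_div_cancel hp.ne', ENNReal.rpow_one]

variable {n : ℕ} {p : ℝ} {Ω Γ : Set (EuclideanSpace ℝ (Fin n))} {y₀ : EuclideanSpace ℝ (Fin n)}
  {σ : EuclideanSpace ℝ (Fin n) → ℝ≥0∞} (c : NormalChart Ω y₀) {h : ℝ → ℝ} {M L : ℝ}
  {K U : Set (hyperplane c.e)} {χ : hyperplane c.e → ℝ}

/-- The test function `δ ^ ((p - 1) / p) h(log δ / L + 4) χ(π)`. -/
noncomputable def NormalChart.testFunction (p : ℝ) (h : ℝ → ℝ) (L : ℝ) (χ : hyperplane c.e → ℝ) :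
    EuclideanSpace ℝ (Fin n) → ℝ :=
  c.push fun ζ => hardyProfile ((p - 1) / p) h L ⟪c.e, ζ⟫ * χ (hyperproj c.e ζ)

/-- A compact set outside of which the test function vanishes, in the coordinates of the chart. -/
def NormalChart.testSet (L : ℝ) (χ : hyperplane c.e → ℝ) : Set (EuclideanSpace ℝ (Fin n)) :=
  (fun w : hyperplane c.e × ℝ => (w.1 : EuclideanSpace ℝ (Fin n)) + w.2 • c.e) ''
    (tsupport χ ×ˢ Icc (Real.exp (-6 * L)) (Real.exp (-2 * L)))

theorem NormalChart.isCompact_testSet (hχ : HasCompactSupport χ) : IsCompact (c.testSet L χ) :=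
  (IsCompact.prod hχ isCompact_Icc).image (by fun_prop)

theorem NormalChart.testSet_subset
    (hLr : Real.exp (-2 * L) < c.radius / 2)
    (hχ : tsupport χ ⊆ Metric.ball (hyperproj c.e y₀) (c.radius / 2)) :
    c.testSet L χ ⊆ c.inner := by
  rintro _ ⟨⟨z, t⟩, ⟨hz, ht⟩, rfl⟩
  have h1 := inner_coe_add_smul c.norm_e z t
  have ht0 : 0 < t := (Real.exp_pos _).trans_le ht.1
  refine ⟨c.mem_source_of_lt ?_ ?_, ?_⟩
  · simp only [hyperproj_coe_add_smul]; exact hχ hz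
  · simp only [h1]
    rw [abs_of_pos ht0]
    exact ht.2.trans_lt hLr
  · change 0 < ⟪c.e, (z : EuclideanSpace ℝ (Fin n)) + t • c.e⟫
    rw [h1]; exact ht0

theorem NormalChart.eq_zero_of_notMem_testSet (hh : IsLogCutoff h M) (hL : 0 < L) {a : ℝ}
    (ζ : EuclideanSpace ℝ (Fin n)) (hζ : ζ ∉ c.testSet L χ) :
    hardyProfile a h L ⟪c.e, ζ⟫ * χ (hyperproj c.e ζ) = 0 := by
  by_contra hne
  rw [← ne_eq, mul_ne_zero_iff] at hne
  refine hζ ⟨(hyperproj c.e ζ, ⟪c.e, ζ⟫), ⟨subset_tsupport _ hne.2, ?_⟩,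
    hyperproj_add_inner_smul c.norm_e ζ⟩
  by_contra hn
  exact hne.1 (hardyProfile_eq_zero hL hh.eq_zero hn)

theorem NormalChart.contDiff_testFunction (hh : IsLogCutoff h M) (hL : 0 < L)
    (hLr : Real.exp (-2 * L) < c.radius / 2)
    (hχ : tsupport χ ⊆ Metric.ball (hyperproj c.e y₀) (c.radius / 2))
    (hχc : HasCompactSupport χ) (hχ1 : ContDiff ℝ 1 χ) :
    ContDiff ℝ 1 (c.testFunction p h L χ) := by
  refine c.contDiff_push (c.isCompact_testSet hχc)
    ((c.testSet_subset hLr hχ).trans inter_subset_left) (c.eq_zero_of_notMem_testSet hh hL) ?_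
  exact ((contDiff_hardyProfile hL hh.contDiff hh.eq_zero).comp
    (contDiff_const.inner ℝ contDiff_id)).mul (hχ1.comp (hyperproj c.e).contDiff)

theorem NormalChart.tsupport_testFunction_subset (hh : IsLogCutoff h M) (hL : 0 < L)
    (hLr : Real.exp (-2 * L) < c.radius / 2)
    (hχ : tsupport χ ⊆ Metric.ball (hyperproj c.e y₀) (c.radius / 2))
    (hχc : HasCompactSupport χ) :
    tsupport (c.testFunction p h L χ) ⊆ c.Φ '' c.inner :=
  (c.tsupport_push_subset (c.isCompact_testSet hχc) (c.eq_zero_of_notMem_testSet hh hL)).trans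
    (image_mono (c.testSet_subset hLr hχ))

theorem NormalChart.hasCompactSupport_testFunction (hh : IsLogCutoff h M) (hL : 0 < L)
    (hχc : HasCompactSupport χ) : HasCompactSupport (c.testFunction p h L χ) :=
  c.hasCompactSupport_push (c.isCompact_testSet hχc) (c.eq_zero_of_notMem_testSet hh hL)

/-- The gradient of the test function, up to an error of relative order `1 / L`. -/
theorem NormalChart.enorm_fderiv_testFunction_le (hp : 1 < p) (hh : IsLogCutoff h M) (hL : 0 < L)
    (hχ1 : ContDiff ℝ 1 χ) (hχU : tsupport χ ⊆ U) (hχ01 : ∀ z, χ z ∈ Icc 0 1) {M' : ℝ}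
    (hM' : ∀ z, ‖fderiv ℝ χ z‖ ≤ M') {ζ : EuclideanSpace ℝ (Fin n)} (hζ : ζ ∈ c.inner) :
    ‖fderiv ℝ (c.testFunction p h L χ) (c.Φ ζ)‖ₑ ≤
      (ENNReal.ofReal ((p - 1) / p) ^ p *
        productDensity c.e U L (fun s => ENNReal.ofReal (h s) ^ p) ζ) ^ (1 / p) +
      (ENNReal.ofReal ((M + M' * c.symmBound) / L) ^ p *
        productDensity c.e U L ((Icc (-2 : ℝ) 2).indicator 1) ζ) ^ (1 / p) := by
  obtain ⟨hζs, ht : 0 < ⟪c.e, ζ⟫⟩ := hζ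
  have hp0 : 0 < p := zero_lt_one.trans hp
  set t := ⟪c.e, ζ⟫ with htdef
  set z := hyperproj c.e ζ with hz
  set a := (p - 1) / p with ha
  have ha0 : 0 ≤ a := div_nonneg (by linarith) hp0.le
  have ha1 : a - 1 = -(1 / p) := by rw [ha]; field_simp; ring
  have hM0 := hh.nonneg_bound
  have hM'0 : 0 ≤ M' := (norm_nonneg (fderiv ℝ χ 0)).trans (hM' 0)
  have hB := c.symmBound_nonneg
  have hle := c.norm_fderiv_push_le hζs ht
    (hasDerivAt_hardyProfile (a := a) (L := L) (hh.contDiff.differentiable (by norm_num)) ht) hχ1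
  rw [← htdef, ← hz] at hle
  by_cases hzU : z ∈ U
  swap
  · have hzt : z ∉ tsupport χ := fun h' => hzU (hχU h')
    have h1 : χ z = 0 := image_eq_zero_of_notMem_tsupport hzt
    have h2 : fderiv ℝ χ z = 0 := by
      by_contra h'
      exact hzt (support_fderiv_subset ℝ h')
    have h3 : ‖fderiv ℝ χ z‖ = 0 := by rw [h2]; exact ContinuousLinearMap.opNorm_zero
    rw [h1, h3, abs_zero, mul_zero, zero_mul, mul_zero, add_zero] at hle
    have : ‖fderiv ℝ (c.testFunction p h L χ) (c.Φ ζ)‖ₑ = 0 := by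
      rw [← ofReal_norm, ENNReal.ofReal_eq_zero]
      exact hle
    rw [this]
    exact zero_le
  by_cases hs : logVar L t ∈ Icc (-2) 2
  swap
  · have h3 : hardyProfile a h L t = 0 := by
      rw [hardyProfile, if_pos ht, hh.eq_zero _ hs, mul_zero]
    rw [h3, hh.eq_zero _ hs, hh.deriv_eq_zero _ hs, mul_zero, zero_div, add_zero, mul_zero,
      abs_zero, zero_mul, zero_mul, add_zero] at hle
    have : ‖fderiv ℝ (c.testFunction p h L χ) (c.Φ ζ)‖ₑ = 0 := by
      rw [← ofReal_norm, ENNReal.ofReal_eq_zero]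
      exact hle
    rw [this]
    exact zero_le
  have hE1 : productDensity c.e U L (fun s => ENNReal.ofReal (h s) ^ p) ζ =
      ENNReal.ofReal t⁻¹ * ENNReal.ofReal (h (logVar L t)) ^ p := by
    rw [productDensity, indicator_of_mem hzU, Pi.one_apply, one_mul]
  have hE2 : productDensity c.e U L ((Icc (-2 : ℝ) 2).indicator 1) ζ =
      ENNReal.ofReal t⁻¹ * ENNReal.ofReal 1 ^ p := by
    rw [productDensity, indicator_of_mem hzU, Pi.one_apply, one_mul, ← htdef, indicator_of_mem hs]
    simp
  have hC0 : 0 ≤ (M + M' * c.symmBound) / L := by positivity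
  rw [hE1, hE2, ofReal_mul_rpow_mul_rpow_inv hp0 ha0 ht (hh.nonneg _),
    ofReal_mul_rpow_mul_rpow_inv hp0 hC0 ht zero_le_one, mul_one,
    ← ENNReal.ofReal_add (mul_nonneg (by positivity) (hh.nonneg _)) (by positivity),
    ← ofReal_norm]
  refine ENNReal.ofReal_le_ofReal (hle.trans ?_)
  have hta : t ^ a = t ^ (a - 1) * t := by
    rw [Real.rpow_sub_one ht.ne']; field_simp
  -- The tangential derivative carries an extra factor `t`. The shift by `4` in `logVar` forces `t ≤
  -- exp (-2L)`, so this factor is absorbed into the `1 / L` error.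
  have htL : t ≤ 1 / L := by
    refine (mem_Icc_of_logVar_mem hL ht hs).2.trans ?_
    rw [neg_mul, Real.exp_neg, inv_eq_one_div]
    refine one_div_le_one_div_of_le hL ?_
    have := Real.add_one_le_exp (2 * L)
    linarith
  rw [hardyProfile, if_pos ht, hta, ha1]
  set T := t ^ (-(1 / p)) with hT
  have hT0 : 0 ≤ T := Real.rpow_nonneg ht.le _
  set H := h (logVar L t)
  have hH0 : 0 ≤ H := hh.nonneg _
  have hH1 : H ≤ 1 := hh.le_one _
  have h1 : |T * (a * H + deriv h (logVar L t) / L)| * |χ z| ≤ T * (a * H + M / L) := by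
    rw [abs_mul, abs_of_nonneg hT0, abs_of_nonneg (hχ01 z).1]
    refine (mul_le_of_le_one_right (by positivity) (hχ01 z).2).trans ?_
    refine mul_le_mul_of_nonneg_left ((abs_add_le _ _).trans ?_) hT0
    rw [abs_of_nonneg (mul_nonneg ha0 hH0), abs_div, abs_of_pos hL]
    have := hh.abs_deriv_le (logVar L t)
    gcongr
  have h2 : |T * t * H| * (‖fderiv ℝ χ z‖ * c.symmBound) ≤ T * ((M' * c.symmBound) / L) := by
    rw [abs_of_nonneg (by positivity)]
    have e1 : T * t * H ≤ T * (1 / L) := by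
      refine (mul_le_of_le_one_right (by positivity) hH1).trans ?_
      exact mul_le_mul_of_nonneg_left htL hT0
    have e2 : ‖fderiv ℝ χ z‖ * c.symmBound ≤ M' * c.symmBound :=
      mul_le_mul_of_nonneg_right (hM' z) hB
    calc _ ≤ T * (1 / L) * (M' * c.symmBound) := by gcongr
      _ = _ := by ring
  calc _ ≤ T * (a * H + M / L) + T * ((M' * c.symmBound) / L) := add_le_add h1 h2
    _ = _ := by ring

/-- A lower bound for the weighted norm of the test function. -/
theorem NormalChart.le_weightedNormPow_testFunction (hp : 1 < p) (hh : IsLogCutoff h M)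
    (hK : MeasurableSet K) (hσ : ∀ z ∈ K, σ (c.g z) = ∞) (hχK : ∀ z ∈ K, χ z = 1) :
    ∫⁻ ζ, productDensity c.e K L (fun s => ENNReal.ofReal (h s) ^ p) ζ ∂c.measure ≤
      weightedNormPow p Ω σ (c.testFunction p h L χ) := by
  have hp0 : 0 < p := zero_lt_one.trans hp
  refine le_trans ?_ (lintegral_mono_set c.image_inner_subset)
  refine c.le_lintegral_image_inner (measurable_productDensity hK hh.measurable_rpow) ?_
  rintro ζ ⟨hζs, ht : 0 < ⟪c.e, ζ⟫⟩
  rw [productDensity]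
  by_cases hz : hyperproj c.e ζ ∈ K
  swap
  · rw [indicator_of_notMem hz, zero_mul]
    exact zero_le
  have hα : robinAlpha p Ω σ (c.Φ ζ) = 0 := by
    have h1 : 1 / (1 - p) < 0 := by
      rw [one_div]; exact inv_lt_zero.2 (by linarith)
    rw [robinAlpha, c.nearestPoint_eq ζ hζs, hσ _ hz, ENNReal.top_rpow_of_neg h1, mul_zero]
  rw [indicator_of_mem hz, Pi.one_apply, one_mul, hα, add_zero, c.bdryDist_eq ζ hζs ht,
    testFunction, c.push_apply hζs, hχK _ hz, mul_one, hardyProfile, if_pos ht]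
  set t := ⟪c.e, ζ⟫
  have hH := hh.nonneg (logVar L t)
  rw [Real.enorm_of_nonneg (by positivity), ENNReal.ofReal_rpow_of_nonneg hH hp0.le,
    ENNReal.ofReal_rpow_of_nonneg ht.le hp0.le,
    ENNReal.ofReal_rpow_of_nonneg (mul_nonneg (Real.rpow_nonneg ht.le _) hH) hp0.le,
    ← ENNReal.ofReal_mul (by positivity), ← ENNReal.ofReal_div_of_pos (by positivity)]
  -- Equality holds here: the exponent `(p - 1) / p` is the one for which `(t ^ a)^p / t^p = t⁻¹`.
  refine ENNReal.ofReal_le_ofReal (le_of_eq ?_)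
  rw [Real.mul_rpow (by positivity) hH, ← Real.rpow_mul ht.le, div_mul_cancel₀ _ hp0.ne',
    Real.rpow_sub_one ht.ne']
  field_simp

/-- The energy of the test function. -/
theorem NormalChart.lintegral_fderiv_testFunction_le (hp : 1 < p) (hh : IsLogCutoff h M)
    (hL : 0 < L) (hLr : Real.exp (-2 * L) < c.radius / 2) (hU : MeasurableSet U)
    (hUr : U ⊆ Metric.ball (hyperproj c.e y₀) (c.radius / 2)) (hχc : HasCompactSupport χ)
    (hχ1 : ContDiff ℝ 1 χ) (hχU : tsupport χ ⊆ U) (hχ01 : ∀ z, χ z ∈ Icc 0 1) {M' : ℝ}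
    (hM' : ∀ z, ‖fderiv ℝ χ z‖ ≤ M') :
    (∫⁻ x in Ω, ‖fderiv ℝ (c.testFunction p h L χ) x‖ₑ ^ p) ^ (1 / p) ≤
      (ENNReal.ofReal ((p - 1) / p) ^ p *
        ∫⁻ ζ, productDensity c.e U L (fun s => ENNReal.ofReal (h s) ^ p) ζ ∂c.measure) ^ (1 / p) +
      (ENNReal.ofReal ((M + M' * c.symmBound) / L) ^ p *
        ∫⁻ ζ, productDensity c.e U L ((Icc (-2 : ℝ) 2).indicator 1) ζ ∂c.measure) ^ (1 / p) := by
  have hp0 : 0 < p := zero_lt_one.trans hp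
  have hm1 : Measurable (productDensity c.e U L (fun s => ENNReal.ofReal (h s) ^ p)) :=
    measurable_productDensity hU hh.measurable_rpow
  have hm2 : Measurable (productDensity c.e U L ((Icc (-2 : ℝ) 2).indicator 1)) :=
    measurable_productDensity hU (measurable_one.indicator measurableSet_Icc)
  set α := fun ζ => (ENNReal.ofReal ((p - 1) / p) ^ p *
    productDensity c.e U L (fun s => ENNReal.ofReal (h s) ^ p) ζ) ^ (1 / p) with hα
  set β := fun ζ => (ENNReal.ofReal ((M + M' * c.symmBound) / L) ^ p *
    productDensity c.e U L ((Icc (-2 : ℝ) 2).indicator 1) ζ) ^ (1 / p) with hβ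
  have hαm : Measurable α := (hm1.const_mul _).pow_const _
  have hβm : Measurable β := (hm2.const_mul _).pow_const _
  have hαi : ∫⁻ ζ, α ζ ^ p ∂c.measure = ENNReal.ofReal ((p - 1) / p) ^ p *
      ∫⁻ ζ, productDensity c.e U L (fun s => ENNReal.ofReal (h s) ^ p) ζ ∂c.measure := by
    rw [← lintegral_const_mul _ hm1]
    refine lintegral_congr fun ζ => ?_
    rw [hα, ← ENNReal.rpow_mul, one_div_mul_cancel hp0.ne', ENNReal.rpow_one]
  have hβi : ∫⁻ ζ, β ζ ^ p ∂c.measure = ENNReal.ofReal ((M + M' * c.symmBound) / L) ^ p *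
      ∫⁻ ζ, productDensity c.e U L ((Icc (-2 : ℝ) 2).indicator 1) ζ ∂c.measure := by
    rw [← lintegral_const_mul _ hm2]
    refine lintegral_congr fun ζ => ?_
    rw [hβ, ← ENNReal.rpow_mul, one_div_mul_cancel hp0.ne', ENNReal.rpow_one]
  rw [← hαi, ← hβi]
  -- Minkowski's inequality for `c.measure` separates the main term from the error.
  refine le_trans (ENNReal.rpow_le_rpow ?_ (by positivity))
    (ENNReal.lintegral_Lp_add_le hαm.aemeasurable hβm.aemeasurable hp.le)
  have hsupp : Function.support (fun x => ‖fderiv ℝ (c.testFunction p h L χ) x‖ₑ ^ p) ⊆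
      c.Φ '' c.inner := by
    intro x hx
    refine c.tsupport_testFunction_subset (p := p) hh hL hLr (hχU.trans hUr) hχc
      (support_fderiv_subset ℝ fun h0 => hx ?_)
    have h1 : ‖fderiv ℝ (c.testFunction p h L χ) x‖ₑ = 0 := by
      rw [← ofReal_norm, ENNReal.ofReal_eq_zero]
      exact (norm_eq_zero.2 h0).le
    change ‖fderiv ℝ (c.testFunction p h L χ) x‖ₑ ^ p = 0
    rw [h1, ENNReal.zero_rpow_of_pos hp0]
  refine (setLIntegral_le_lintegral Ω _).trans ?_
  rw [← setLIntegral_eq_of_support_subset hsupp]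
  refine c.lintegral_image_inner_le ((hαm.add hβm).pow_const p) fun ζ hζ => ?_
  exact ENNReal.rpow_le_rpow
    (c.enorm_fderiv_testFunction_le hp hh hL hχ1 hχU hχ01 hM' hζ) hp0.le

end TestFunction

/-! ### The Hardy quotient of the test function -/

section UpperBound

variable {n : ℕ} {p : ℝ} {Ω Γ : Set (EuclideanSpace ℝ (Fin n))} {y₀ : EuclideanSpace ℝ (Fin n)}
  {σ : EuclideanSpace ℝ (Fin n) → ℝ≥0∞} (c : NormalChart Ω y₀) {h : ℝ → ℝ} {M L : ℝ}
  {K U : Set (hyperplane c.e)} {χ : hyperplane c.e → ℝ}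

/-- The quotient of the bounds for the Jacobian determinant of a chart. -/
noncomputable def NormalChart.distortion : ℝ≥0 := c.detUpper / c.detLower

/-- This turns upper Jacobian bounds into multiples of the lower bound for the denominator. It is
used only for the excess `U \ K` and for the error term, so the distortion does not affect the
limit. -/
theorem NormalChart.distortion_mul (x : ℝ≥0∞) :
    (c.distortion : ℝ≥0∞) * (c.detLower * x) = c.detUpper * x := by
  rw [← mul_assoc, ← ENNReal.coe_mul, distortion, div_mul_cancel₀ _ c.detLower_pos.ne']

/-- The bound for the Hardy constant given by the test function at logarithmic scale `L`. -/
theorem NormalChart.hardyConstant_le_of_cutoff (hp : 1 < p) (hΩ : IsOpen Ω)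
    (hb : Bornology.IsBounded Ω) (hΓ : Γ ⊆ frontier Ω) (hy₀ : y₀ ∈ frontier Ω)
    (hh : IsLogCutoff h M) (hL : 0 < L) (hLr : Real.exp (-2 * L) < c.radius / 2)
    (hK : MeasurableSet K) (hK0 : volume K ≠ 0)
    (hσ : ∀ z ∈ K, σ (c.g z) = ∞) (hU : MeasurableSet U) (hKU : K ⊆ U)
    (hUr : U ⊆ Metric.ball (hyperproj c.e y₀) (c.radius / 2)) {η : ℝ≥0}
    (hη : volume (U \ K) ≤ η * volume K) (hχc : HasCompactSupport χ)
    (hχ1 : ContDiff ℝ 1 χ) (hχU : tsupport χ ⊆ U) (hχ01 : ∀ z, χ z ∈ Icc 0 1)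
    (hχK : ∀ z ∈ K, χ z = 1) {M' : ℝ} (hM' : ∀ z, ‖fderiv ℝ χ z‖ ≤ M') :
    hardyConstant p Ω Γ σ ≤
      ((ENNReal.ofReal ((p - 1) / p) ^ p * (1 + c.distortion * η)) ^ (1 / p) +
        (ENNReal.ofReal ((M + M' * c.symmBound) / L) ^ p *
          (c.distortion * ((1 + η) * 4))) ^ (1 / p)) ^ p := by
  have hp0 : 0 < p := zero_lt_one.trans hp
  obtain ⟨κ, hκ, hbounds⟩ := c.exists_lintegral_productDensity_bounds
  set H : ℝ → ℝ≥0∞ := fun s => ENNReal.ofReal (h s) ^ p with hH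
  have hHm : Measurable H := hh.measurable_rpow
  have hH0 : ∀ s, s ∉ Icc (-2) 2 → H s = 0 := fun s hs => by
    simp [hH, hh.eq_zero s hs, ENNReal.zero_rpow_of_pos hp0]
  set J := ENNReal.ofReal L * ∫⁻ s, H s with hJ
  have hLJ : ENNReal.ofReal L ≤ J := le_mul_of_one_le_right' hh.one_le_lintegral
  have hJ0 : J ≠ 0 := ((ENNReal.ofReal_pos.2 hL).trans_le hLJ).ne'
  set Y := ∫⁻ ζ, productDensity c.e K L H ζ ∂c.measure with hY
  have hYlow : c.detLower * (κ * (volume K * J)) ≤ Y :=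
    (hbounds K L H hK hHm hL).2 hLr (hKU.trans hUr) hH0
  have hY0 : Y ≠ 0 := by
    refine (lt_of_lt_of_le (pos_iff_ne_zero.2 ?_) hYlow).ne'
    exact mul_ne_zero (ENNReal.coe_ne_zero.2 c.detLower_pos.ne')
      (mul_ne_zero (ENNReal.coe_ne_zero.2 hκ) (mul_ne_zero hK0 hJ0))
  set u := c.testFunction p h L χ with hu
  have hYW : Y ≤ weightedNormPow p Ω σ u := c.le_weightedNormPow_testFunction hp hh hK hσ hχK
  -- the main term
  have hX : ∫⁻ ζ, productDensity c.e U L H ζ ∂c.measure ≤ (1 + c.distortion * η) * Y := by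
    have hsplit : ∀ ζ, productDensity c.e U L H ζ =
        productDensity c.e K L H ζ + productDensity c.e (U \ K) L H ζ := fun ζ => by
      rw [productDensity, productDensity, productDensity, ← add_mul]
      congr 1
      have := congrFun (indicator_union_of_disjoint (disjoint_sdiff_right (s := K) (t := U))
        (1 : hyperplane c.e → ℝ≥0∞)) (hyperproj c.e ζ)
      rwa [union_sdiff_cancel hKU] at this
    rw [lintegral_congr hsplit, lintegral_add_left (measurable_productDensity hK hHm), add_mul,
      one_mul]
    refine add_le_add le_rfl ?_
    calc _ ≤ c.detUpper * (κ * (volume (U \ K) * J)) := (hbounds _ L H (hU.diff hK) hHm hL).1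
      _ ≤ c.detUpper * (κ * ((η * volume K) * J)) := by gcongr
      _ = c.distortion * η * (c.detLower * (κ * (volume K * J))) := by
        rw [← c.distortion_mul]; ring
      _ ≤ _ := by gcongr
  -- the error term
  have hZ : ∫⁻ ζ, productDensity c.e U L ((Icc (-2 : ℝ) 2).indicator 1) ζ ∂c.measure ≤
      c.distortion * ((1 + η) * 4) * Y := by
    have hvol : volume U ≤ (1 + η) * volume K := by
      rw [← union_sdiff_cancel hKU, add_mul, one_mul]
      exact (measure_union_le _ _).trans (add_le_add le_rfl hη)
    have h4 : ∫⁻ s, (Icc (-2 : ℝ) 2).indicator 1 s = (4 : ℝ≥0∞) := by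
      rw [lintegral_indicator_one measurableSet_Icc, Real.volume_Icc]
      norm_num
    calc _ ≤ c.detUpper * (κ * (volume U * (ENNReal.ofReal L * 4))) := by
          rw [← h4]
          exact (hbounds U L _ hU (measurable_one.indicator measurableSet_Icc) hL).1
      _ ≤ c.detUpper * (κ * (((1 + η) * volume K) * (J * 4))) := by gcongr
      _ = c.distortion * ((1 + η) * 4) * (c.detLower * (κ * (volume K * J))) := by
        rw [← c.distortion_mul]; ring
      _ ≤ _ := by gcongr
  have hE := c.lintegral_fderiv_testFunction_le hp hh hL hLr hU hUr hχc hχ1 hχU hχ01 hM'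
  set R := (ENNReal.ofReal ((p - 1) / p) ^ p * (1 + c.distortion * η)) ^ (1 / p) +
        (ENNReal.ofReal ((M + M' * c.symmBound) / L) ^ p *
          (c.distortion * ((1 + η) * 4))) ^ (1 / p) with hR
  -- The quantities `κ`, `volume K` and `∫ h^p` are all absorbed in `Y`; of `L`, only the decaying
  -- `1 / L` survives in `R`.
  have hE' : (∫⁻ x in Ω, ‖fderiv ℝ u x‖ₑ ^ p) ^ (1 / p) ≤ R * Y ^ (1 / p) := by
    refine hE.trans ?_
    have hp1 : 0 ≤ 1 / p := by positivity
    rw [hR, add_mul, ← ENNReal.mul_rpow_of_nonneg _ _ hp1, ← ENNReal.mul_rpow_of_nonneg _ _ hp1,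
      mul_assoc, mul_assoc]
    gcongr
  have hE'' : ∫⁻ x in Ω, ‖fderiv ℝ u x‖ₑ ^ p ≤ R ^ p * Y := by
    have := ENNReal.rpow_le_rpow hE' hp0.le
    rwa [ENNReal.mul_rpow_of_nonneg _ _ hp0.le, ← ENNReal.rpow_mul, ← ENNReal.rpow_mul,
      one_div_mul_cancel hp0.ne', ENNReal.rpow_one, ENNReal.rpow_one] at this
  have hχr := hχU.trans hUr
  have hu1 : ContDiff ℝ 1 u := c.contDiff_testFunction hh hL hLr hχr hχc hχ1
  have huc : HasCompactSupport u := c.hasCompactSupport_testFunction hh hL hχc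
  have hus : tsupport u ⊆ Ω := ((c.tsupport_testFunction_subset hh hL hLr hχr hχc).trans
    c.image_inner_subset).trans sdiff_subset
  refine (hardyConstant_le_of_contDiff hp hΩ hΓ hu1 huc hus
    ((pos_iff_ne_zero.2 hY0).trans_le hYW).ne'
    (weightedNormPow_ne_top hp hΩ hb ⟨y₀, hy₀⟩ hu1.continuous huc hus)).trans ?_
  exact ENNReal.div_le_of_le_mul (hE''.trans (mul_le_mul_right hYW _))

end UpperBound
end RobinHardy

/-! ### Passage to the limit -/

theorem proposition4p2 (n : ℕ) (p : ℝ) (hp : 1 < p)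
    (Ω : Set (EuclideanSpace ℝ (Fin n))) (hΩ_open : IsOpen Ω)
    (hΩ_bounded : Bornology.IsBounded Ω) (hΩ_C2 : RobinHardy.HasC2Boundary Ω)
    (Γ : Set (EuclideanSpace ℝ (Fin n))) (hΓ : Γ ⊆ frontier Ω)
    (hΓ_pos : RobinHardy.surfaceMeasure Ω Γ ≠ 0)
    (σ : EuclideanSpace ℝ (Fin n) → ENNReal) (hσ : RobinHardy.IsRobinCoefficient Ω Γ σ) :
    RobinHardy.hardyConstant p Ω Γ σ ≤ ENNReal.ofReal (((p - 1) / p) ^ p) := by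
  have hp0 : 0 < p := zero_lt_one.trans hp
  -- A point of `Γ` all of whose neighbourhoods in `Γ` have positive measure; the whole construction
  -- takes place in one chart there.
  obtain ⟨y₀, hy₀Γ, hpos⟩ := exists_mem_forall_mem_nhdsWithin_pos_measure hΓ_pos
  have hy₀ := hΓ hy₀Γ
  obtain ⟨c⟩ := hΩ_C2.nonempty_normalChart hΩ_open hy₀
  obtain ⟨A, hAm, hAr, hA0, hAσ⟩ :=
    c.exists_measurableSet_sigma_eq_top hσ hpos (half_pos c.radius_pos)
  obtain ⟨h, M, hh⟩ := RobinHardy.exists_isLogCutoff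
  have hAr' := hAr.trans inter_subset_left
  have hAtop : volume A ≠ ∞ := ((measure_mono hAr').trans_lt Metric.isBounded_ball.measure_lt_top).ne
  set a := ENNReal.ofReal ((p - 1) / p) ^ p with ha
  have hatop : a ≠ ∞ := ENNReal.rpow_ne_top_of_nonneg hp0.le ENNReal.ofReal_ne_top
  have hstep : ∀ η : ℝ≥0, η ≠ 0 →
      RobinHardy.hardyConstant p Ω Γ σ ≤ a * (1 + c.distortion * η) := by
    intro η hη
    obtain ⟨K, U, χ, hK, hKA, hK0, hU, hUr, hKU, hUK, hχ1, hχc, hχU, hχ01, hχK⟩ :=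
      RobinHardy.exists_contDiff_cutoff hAm Metric.isOpen_ball hAr' hA0 hAtop hη
    obtain ⟨M', hM'⟩ := (hχ1.continuous_fderiv (by norm_num)).bounded_above_of_compact_support
      (hχc.fderiv (𝕜 := ℝ))
    have hbound : ∀ᶠ L : ℝ in atTop, RobinHardy.hardyConstant p Ω Γ σ ≤
        ((a * (1 + c.distortion * η)) ^ (1 / p) +
          (ENNReal.ofReal ((M + M' * c.symmBound) / L) ^ p *
            (c.distortion * ((1 + η) * 4))) ^ (1 / p)) ^ p := by
      have hexp : Tendsto (fun L : ℝ => Real.exp (-2 * L)) atTop (𝓝 0) :=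
        Real.tendsto_exp_atBot.comp (tendsto_id.const_mul_atTop_of_neg (by norm_num))
      filter_upwards [eventually_gt_atTop 0, hexp.eventually_lt_const (half_pos c.radius_pos)]
        with L hL hLr
      exact c.hardyConstant_le_of_cutoff hp hΩ_open hΩ_bounded hΓ hy₀ hh hL hLr hK hK0
        (fun z hz => hAσ z (hKA hz)) hU.measurableSet hKU hUr hUK hχc hχ1 hχU hχ01 hχK hM'
    have hlim : Tendsto (fun L : ℝ => ((a * (1 + c.distortion * η)) ^ (1 / p) +
          (ENNReal.ofReal ((M + M' * c.symmBound) / L) ^ p *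
            (c.distortion * ((1 + η) * 4))) ^ (1 / p)) ^ p) atTop
        (𝓝 (((a * (1 + c.distortion * η)) ^ (1 / p) +
          (ENNReal.ofReal 0 ^ p * (c.distortion * ((1 + η) * 4))) ^ (1 / p)) ^ p)) := by
      refine Tendsto.ennrpow_const _ (tendsto_const_nhds.add (Tendsto.ennrpow_const _ ?_))
      refine ENNReal.Tendsto.mul_const (Tendsto.ennrpow_const _ ?_) (Or.inr (by finiteness))
      exact ENNReal.tendsto_ofReal (tendsto_const_nhds.div_atTop tendsto_id)
    -- The limit `L → ∞` is taken with `η`, and hence `χ` and the bound `M'` on its gradient, fixed;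
    -- `M'` may blow up as `η → 0`.
    have := ge_of_tendsto hlim hbound
    rwa [ENNReal.ofReal_zero, ENNReal.zero_rpow_of_pos hp0, zero_mul,
      ENNReal.zero_rpow_of_pos (by positivity), add_zero, ← ENNReal.rpow_mul,
      one_div_mul_cancel hp0.ne', ENNReal.rpow_one] at this
  have hlim : Tendsto (fun η : ℝ≥0 => a * (1 + c.distortion * η)) (𝓝[≠] 0)
      (𝓝 (a * (1 + c.distortion * (0 : ℝ≥0)))) := by
    refine Tendsto.mono_left ?_ nhdsWithin_le_nhds
    refine ENNReal.Tendsto.const_mul (tendsto_const_nhds.add ?_) (Or.inr hatop)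
    exact ENNReal.Tendsto.const_mul (ENNReal.tendsto_coe.2 tendsto_id)
      (Or.inr ENNReal.coe_ne_top)
  have hfin := ge_of_tendsto hlim (eventually_nhdsWithin_of_forall fun η hη => hstep η hη)
  rwa [ENNReal.coe_zero, mul_zero, add_zero, mul_one, ha,
    ENNReal.ofReal_rpow_of_nonneg (div_nonneg (by linarith) hp0.le) hp0.le] at hfin
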